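/- Conventions. Categories are locally small, filtered index categories are small, an ind-object $``\varinjlim"X_i$ is indexed by a small filtered category, with $\mathrm{Hom}(``\varinjlim"X_i,``\varinjlim"Y_j)=\varprojlim_i\varinjlim_j\mathrm{Hom}(X_i,Y_j)$, and $\mathrm{Pro}(\mathcal C)=\mathrm{Ind}(\mathcal C^{op})^{op}$. An exact category (in the sense of Quillen) is an additive category $\mathcal A$ with a class $\mathcal E$ of sequences $a'\xrightarrow{i}a\xrightarrow{j}a''$, where $i$ is a kernel of $j$ and $j$ is a cokernel of $i$ (such $i$ are called admissible monomorphisms, such $j$ admissible epimorphisms), such that: $\mathcal E$ is closed under isomorphism and contains all sequences $a'\to a'\oplus a''\to a''$; admissible monomorphisms and admissible epimorphisms are each closed under composition; the pullback of an admissible epimorphism along any morphism exists and is an admissible epimorphism; the pushout of an admissible monomorphism along any morphism exists and is an admissible monomorphism; if $f$ has a kernel in $\mathcal A$ and $fg$ is an admissible epimorphism for some $g$, then $f$ is an admissible epimorphism, and dually for admissible monomorphisms. Proposition. Let $(\mathcal A,\mathcal E)$ be an exact category. Let $\mathcal F$ be its abelian envelope, the category of additive functors $G:\mathcal A^{op}\to\mathbf{Ab}$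 (with values in abelian groups of a universe for which $\mathcal A$ is small) such that $0\to G(a'')\to G(a)\to G(a')$ is exact for every $a'\to a\to a''$ in $\mathcal E$, and let $h:\mathcal A\to\mathcal F$, $a\mapsto\mathrm{Hom}(-,a)$, be the Yoneda embedding. In $\mathrm{Ind}(\mathcal F)$ and $\mathrm{Pro}(\mathcal F)$, index categories are small for that same universe. Then: 1. The categories $\mathrm{Ind}(\mathcal F)$ and $\mathrm{Pro}(\mathcal F)$ are abelian. The functors $\mathrm{Ind}(h):\mathrm{Ind}(\mathcal A)\to\mathrm{Ind}(\mathcal F)$ and $\mathrm{Pro}(h):\mathrm{Pro}(\mathcal A)\to\mathrm{Pro}(\mathcal F)$ are fully faithful, and their essential images are closed under extensions. 2. The category $\mathrm{Ind}(\mathcal A)$, with the class of those sequences that $\mathrm{Ind}(h)$ sends to short exact sequences of $\mathrm{Ind}(\mathcal F)$, is an exact category. Likewise $\mathrm{Pro}(\mathcal A)$, with the class of those sequences that $\mathrm{Pro}(h)$ sends to short exact sequences of $\mathrm{Pro}(\mathcal F)$, is an exact category. 3. Every category obtained from $\mathcal A$ by applying $\mathrm{Ind}$ and $\mathrm{Pro}$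 finitely many times (at least once), in any order, is an exact category, for the class of sequences obtained by repeating the construction in part 2 at each step. In particular $\mathrm{Ind}\,\mathrm{Pro}(\mathcal A)$ and $\mathrm{Pro}\,\mathrm{Ind}(\mathcal A)$ are exact categories. -/

import Mathlib

open CategoryTheory Limits Opposite

universe v u v₁ u₁

namespace IndPro

section IndAdditive
variable {A : Type u} [Category.{v} A] [Preadditive A]

/-- The ind-object `X = “colim” Xᵢ` as a presheaf of abelian groups, `a ↦ colimᵢ Hom(a, Xᵢ)`. -/
noncomputable def addPresheaf (X : Ind A) : Aᵒᵖ ⥤ AddCommGrpCat.{v} :=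
  colimit (X.presentation.F ⋙ preadditiveYoneda)

/-- The presheaf of sets underlying `addPresheaf X` is the presheaf of sets `X`. -/
noncomputable def addPresheafForget (X : Ind A) :
    addPresheaf X ⋙ forget AddCommGrpCat.{v} ≅ (Ind.inclusion A).obj X :=
  (isColimitOfPreserves ((Functor.whiskeringRight Aᵒᵖ AddCommGrpCat.{v} (Type v)).obj
    (forget AddCommGrpCat.{v})) (colimit.isColimit (X.presentation.F ⋙ preadditiveYoneda))
    ).coconePointUniqueUpToIso X.presentation.isColimit

theorem addPresheaf_exists_rep (X : Ind A) (a : Aᵒᵖ) (x : (addPresheaf X).obj a) :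
    ∃ (i : X.presentation.I) (f : a.unop ⟶ X.presentation.F.obj i),
      (colimit.ι (X.presentation.F ⋙ preadditiveYoneda) i).app a f = x :=
  Concrete.isColimit_exists_rep _ (isColimitOfPreserves ((evaluation Aᵒᵖ AddCommGrpCat.{v}).obj a)
    (colimit.isColimit (X.presentation.F ⋙ preadditiveYoneda))) x

theorem addPresheaf_exists_rep₂ (X : Ind A) (a : Aᵒᵖ) (x y : (addPresheaf X).obj a) :
    ∃ (i : X.presentation.I) (f g : a.unop ⟶ X.presentation.F.obj i),
      (colimit.ι (X.presentation.F ⋙ preadditiveYoneda) i).app a f = x ∧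
      (colimit.ι (X.presentation.F ⋙ preadditiveYoneda) i).app a g = y := by
  obtain ⟨i, f, rfl⟩ := addPresheaf_exists_rep X a x
  obtain ⟨j, g, rfl⟩ := addPresheaf_exists_rep X a y
  refine ⟨IsFiltered.max i j, f ≫ X.presentation.F.map (IsFiltered.leftToMax i j),
    g ≫ X.presentation.F.map (IsFiltered.rightToMax i j), ?_, ?_⟩
  · exact congr($(congr_app (colimit.w (X.presentation.F ⋙ preadditiveYoneda)
      (IsFiltered.leftToMax i j)) a) f)
  · exact congr($(congr_app (colimit.w (X.presentation.F ⋙ preadditiveYoneda)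
      (IsFiltered.rightToMax i j)) a) g)

instance (X : Ind A) : (addPresheaf X).Additive where
  map_add {a b f g} := by
    ext x
    obtain ⟨i, h, rfl⟩ := addPresheaf_exists_rep X a x
    have key (k : a ⟶ b) : (addPresheaf X).map k
        ((colimit.ι (X.presentation.F ⋙ preadditiveYoneda) i).app a h) =
        (colimit.ι (X.presentation.F ⋙ preadditiveYoneda) i).app b (k.unop ≫ h) :=
      (congr($((colimit.ι (X.presentation.F ⋙ preadditiveYoneda) i).naturality k) h)).symm
    refine (key (f + g)).trans (Eq.trans ?_ (congrArg₂ (· + ·) (key f) (key g)).symm)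
    refine (congrArg _ (Preadditive.add_comp _ _ _ f.unop g.unop h)).trans ?_
    exact AddMonoidHom.map_add _ _ _

/-- Natural maps of sets from an ind-object to an additive presheaf of groups are additive. -/
theorem addPresheaf_hom_add {X : Ind A} {G : Aᵒᵖ ⥤ AddCommGrpCat.{v}} [G.Additive]
    (φ : addPresheaf X ⋙ forget AddCommGrpCat.{v} ⟶ G ⋙ forget AddCommGrpCat.{v}) (a : Aᵒᵖ)
    (x y : (addPresheaf X).obj a) :
    (φ.app a (x + y : (addPresheaf X).obj a) : G.obj a) =
      (φ.app a x : G.obj a) + (φ.app a y : G.obj a) := by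
  obtain ⟨i, f, g, rfl, rfl⟩ := addPresheaf_exists_rep₂ X a x y
  let F := X.presentation.F
  let ι := colimit.ι (X.presentation.F ⋙ preadditiveYoneda) i
  let t : G.obj (op (F.obj i)) := φ.app (op (F.obj i)) (ι.app (op (F.obj i)) (𝟙 (F.obj i)))
  have key (k : a.unop ⟶ F.obj i) : (φ.app a (ι.app a k) : G.obj a) = G.map k.op t := by
    have h1 := congr($(φ.naturality k.op) (ι.app (op (F.obj i)) (𝟙 (F.obj i))))
    have h2 := congr($(ι.naturality k.op) (𝟙 (F.obj i)))
    have h3 : ι.app a k = (addPresheaf X).map k.op (ι.app (op (F.obj i)) (𝟙 (F.obj i))) := by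
      refine Eq.trans ?_ h2
      exact congrArg (ι.app a) (Category.comp_id k).symm
    rw [h3]
    exact h1
  have h4 : ι.app a f + ι.app a g = ι.app a (f + g) := ((ι.app a).hom.map_add f g).symm
  change (φ.app a (ι.app a f + ι.app a g) : G.obj a) = φ.app a (ι.app a f) + φ.app a (ι.app a g)
  rw [h4, key, key, key, op_add, G.map_add]
  rfl

variable (A) in
/-- Ind-objects as presheaves of abelian groups. -/
noncomputable def indToAdd : Ind A ⥤ Aᵒᵖ ⥤ AddCommGrpCat.{v} where
  obj := addPresheaf
  map {X Y} f := 
    let φ := (addPresheafForget X).hom ≫ (Ind.inclusion A).map f ≫ (addPresheafForget Y).inv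
    { app a := AddCommGrpCat.ofHom
        (AddMonoidHom.mk' (fun x => φ.app a x) (addPresheaf_hom_add φ a))
      naturality a b k := by
        ext x
        exact congr($(φ.naturality k) x) }
  map_id X := by
    ext a x
    simp
  map_comp f g := by
    ext a x
    simp

/-- `indToAdd` is fully faithful. -/
noncomputable def indToAddFullyFaithful : (indToAdd A).FullyFaithful where
  preimage {X Y} φ := (Ind.inclusion.fullyFaithful (C := A)).preimage
    ((addPresheafForget X).inv ≫ Functor.whiskerRight φ (forget AddCommGrpCat.{v}) ≫
      (addPresheafForget Y).hom)
  map_preimage φ := by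
    ext a x
    simp [indToAdd]
    rfl
  preimage_map f := by
    apply (Ind.inclusion A).map_injective
    ext a x
    simp only [indToAdd, Functor.FullyFaithful.map_preimage, NatTrans.comp_app,
      Functor.whiskerRight_app, ConcreteCategory.comp_apply]
    refine (congr($((addPresheafForget _).inv_hom_id_app a) _)).trans ?_
    exact congrArg (((Ind.inclusion A).map f).app a)
      (congr($((addPresheafForget _).inv_hom_id_app a) x))

/-- The addition of morphisms of ind-objects of a preadditive category, induced by the addition
on `lim_i colim_j Hom(Xᵢ, Yⱼ)`. -/
noncomputable instance indPreadditive : Preadditive (Ind A) :=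
  Preadditive.ofFullyFaithful indToAddFullyFaithful

/-- The category of pro-objects, `Pro(C) = Ind(Cᵒᵖ)ᵒᵖ`. -/
abbrev Pro (C : Type u) [Category.{v} C] : Type (max u (v + 1)) := (Ind Cᵒᵖ)ᵒᵖ

end IndAdditive

section IndMap
variable {A : Type u} [Category.{v} A] {B : Type u₁} [Category.{max u v} B]

/-- The left Kan extension of presheaves along `h` (with a change of universe). -/
noncomputable def presheafMap (h : A ⥤ B) : (Aᵒᵖ ⥤ Type v) ⥤ (Bᵒᵖ ⥤ Type (max u v)) :=
  (Functor.whiskeringRight Aᵒᵖ (Type v) (Type (max u v))).obj uliftFunctor.{u, v} ⋙ h.op.lan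

/-- `presheafMap h` sends the presheaf represented by `a` to the one represented by `h a`. -/
noncomputable def presheafMapYoneda (h : A ⥤ B) : yoneda ⋙ presheafMap h ≅ h ⋙ yoneda :=
  Functor.isoWhiskerRight (show yoneda ⋙ (Functor.whiskeringRight Aᵒᵖ (Type v) (Type (max u v))).obj
      uliftFunctor.{u, v} ≅ uliftYoneda.{max u v} from
    NatIso.ofComponents fun X ↦ NatIso.ofComponents fun Y ↦
      (Equiv.ulift.trans Equiv.ulift.symm).toIso) h.op.lan ≪≫
    (Presheaf.compULiftYonedaIsoULiftYonedaCompLan.{u} h).symm ≪≫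
    Functor.isoWhiskerLeft h (NatIso.ofComponents fun X ↦ NatIso.ofComponents fun Y ↦
      Equiv.ulift.toIso)

instance (h : A ⥤ B) : PreservesColimitsOfSize.{v, v} (presheafMap h) := by
  have : PreservesColimitsOfSize.{v, v} ((Functor.whiskeringRight Aᵒᵖ (Type v) (Type (max u v))).obj uliftFunctor.{u, v}) := inferInstance
  have : PreservesColimitsOfSize.{v, v} (h.op.lan (H := Type (max u v))) := (h.op.lanAdjunction _).leftAdjoint_preservesColimits
  unfold presheafMap
  infer_instance

theorem isIndObject_presheafMap (h : A ⥤ B) (X : Ind A) :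
    IsIndObject ((presheafMap h).obj ((Ind.inclusion A).obj X)) := by
  let P := X.presentation
  let e : AsSmall.{u} P.I ≌ P.I := AsSmall.equiv.symm
  have hc := isColimitOfPreserves (presheafMap h) P.isColimit
  let i : e.functor ⋙ (P.F ⋙ h) ⋙ yoneda ≅ e.functor ⋙ (P.F ⋙ yoneda) ⋙ presheafMap h := 
    Functor.isoWhiskerLeft e.functor (Functor.isoWhiskerLeft P.F (presheafMapYoneda h).symm)
  have hc' := (IsColimit.precomposeHomEquiv i _).symm (hc.whiskerEquivalence e)
  have : IsFiltered (AsSmall.{u} P.I) := IsFiltered.of_equivalence e.symm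
  exact ⟨⟨{ I := AsSmall.{u} P.I, F := e.functor ⋙ P.F ⋙ h, ι := _, isColimit := hc' }⟩⟩

/-- The functor `Ind(h) : Ind(A) ⥤ Ind(B)`, `“colim” Xᵢ ↦ “colim” h(Xᵢ)`, obtained by restricting the
left Kan extension of presheaves along `h` to ind-objects. The index categories are `v`-small in
`Ind(A)` and `max u v`-small in `Ind(B)`. -/
noncomputable def indMap (h : A ⥤ B) : Ind A ⥤ Ind B :=
  ObjectProperty.lift _ (Ind.inclusion A ⋙ presheafMap h) (isIndObject_presheafMap h) ⋙
    (Ind.equivalence B).inverse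

/-- On underlying presheaves, `indMap h` is `presheafMap h`. -/
noncomputable def indMapInclusion (h : A ⥤ B) :
    indMap h ⋙ Ind.inclusion B ≅ Ind.inclusion A ⋙ presheafMap h :=
  Functor.isoWhiskerLeft (ObjectProperty.lift _ (Ind.inclusion A ⋙ presheafMap h) (isIndObject_presheafMap h))
    (Functor.isoWhiskerRight (Ind.equivalence B).counitIso (ObjectProperty.ι _))

/-- `indMap h` extends `h`. -/
noncomputable def indMapYoneda (h : A ⥤ B) : Ind.yoneda ⋙ indMap h ≅ h ⋙ Ind.yoneda :=
  (Ind.inclusion.fullyFaithful (C := B)).whiskeringRight _ |>.preimageIso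
   (Functor.isoWhiskerLeft Ind.yoneda (indMapInclusion h) ≪≫
    Functor.isoWhiskerRight Ind.yonedaCompInclusion (presheafMap h) ≪≫ presheafMapYoneda h ≪≫
    Functor.isoWhiskerLeft h Ind.yonedaCompInclusion.symm)

/-- `presheafMap h` is fully faithful if `h` is. -/
noncomputable def presheafMapFullyFaithful (h : A ⥤ B) [h.Full] [h.Faithful] :
    (presheafMap h).FullyFaithful :=
  (Functor.FullyFaithful.whiskeringRight (fullyFaithfulULiftFunctor.{u, v}) Aᵒᵖ).comp
    (h.op.lanAdjunction (Type (max u v))).fullyFaithfulLOfIsIsoUnit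

instance (h : A ⥤ B) [h.Full] [h.Faithful] : (presheafMap h).Full :=
  (presheafMapFullyFaithful h).full
instance (h : A ⥤ B) [h.Full] [h.Faithful] : (presheafMap h).Faithful :=
  (presheafMapFullyFaithful h).faithful

instance (h : A ⥤ B) [h.Full] [h.Faithful] : (indMap h).Full := by
  unfold indMap; infer_instance
instance (h : A ⥤ B) [h.Full] [h.Faithful] : (indMap h).Faithful := by
  unfold indMap; infer_instance

/-- The functor `Pro(h) : Pro(A) ⥤ Pro(B)`, `“lim” Xᵢ ↦ “lim” h(Xᵢ)`. -/
noncomputable def proMap (h : A ⥤ B) : Pro A ⥤ Pro B := (indMap h.op).op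

instance (h : A ⥤ B) [h.Full] [h.Faithful] : (proMap h).Full := by
  unfold proMap; infer_instance
instance (h : A ⥤ B) [h.Full] [h.Faithful] : (proMap h).Faithful := by
  unfold proMap; infer_instance

end IndMap

/-- `S.f` is a kernel of `S.g` and `S.g` is a cokernel of `S.f`, that is, `0 → X₁ → X₂ → X₃ → 0` is a
short exact sequence. -/
def IsKernelCokernelPair {A : Type u} [Category.{v} A] [HasZeroMorphisms A]
    (S : ShortComplex A) : Prop :=
  Nonempty (IsLimit (KernelFork.ofι S.f S.zero)) ∧
    Nonempty (IsColimit (CokernelCofork.ofπ S.g S.zero))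

theorem IsKernelCokernelPair.of_map {A : Type u} [Category.{v} A] [HasZeroMorphisms A]
    {B : Type u₁} [Category.{v₁} B] [HasZeroMorphisms B] (F : A ⥤ B) [F.Full] [F.Faithful]
    {S : ShortComplex A} (hS : IsKernelCokernelPair (S.map F)) : IsKernelCokernelPair S :=
  ⟨hS.1.map fun h ↦ isLimitOfReflects F
      ((KernelFork.isLimitMapConeEquiv (KernelFork.ofι S.f S.zero) F).symm h),
    hS.2.map fun h ↦ isColimitOfReflects F
      ((CokernelCofork.isColimitMapCoconeEquiv (CokernelCofork.ofπ S.g S.zero) F).symm h)⟩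

/-- A class of short exact sequences (kernel-cokernel pairs) in a preadditive category. -/
structure SequenceClass (A : Type u) [Category.{v} A] [Preadditive A] where
  mem : ShortComplex A → Prop
  isKernelCokernelPair {S : ShortComplex A} : mem S → IsKernelCokernelPair S

namespace SequenceClass
variable {A : Type u} [Category.{v} A] [Preadditive A] (E : SequenceClass A)

/-- `i` occurs as the first map of a sequence of the class. -/
def AdmissibleMono {a b : A} (i : a ⟶ b) : Prop :=
  ∃ (c : A) (j : b ⟶ c) (w : i ≫ j = 0), E.mem (ShortComplex.mk i j w)

/-- `j` occurs as the second map of a sequence of the class. -/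
def AdmissibleEpi {b c : A} (j : b ⟶ c) : Prop :=
  ∃ (a : A) (i : a ⟶ b) (w : i ≫ j = 0), E.mem (ShortComplex.mk i j w)

/-- Quillen's axioms: `(A, E)` is an exact category. -/
structure IsExact : Prop where
  hasFiniteBiproducts : HasFiniteBiproducts A
  of_iso {S T : ShortComplex A} : Nonempty (S ≅ T) → E.mem S → E.mem T
  split {a c : A} (b : BinaryBicone a c) :
    Nonempty b.IsBilimit → E.mem (ShortComplex.mk b.inl b.snd b.inl_snd)
  comp_epi {a b c : A} (f : a ⟶ b) (g : b ⟶ c) :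
    E.AdmissibleEpi f → E.AdmissibleEpi g → E.AdmissibleEpi (f ≫ g)
  comp_mono {a b c : A} (f : a ⟶ b) (g : b ⟶ c) :
    E.AdmissibleMono f → E.AdmissibleMono g → E.AdmissibleMono (f ≫ g)
  pullback_epi {a c d : A} (j : a ⟶ c) (f : d ⟶ c) : E.AdmissibleEpi j →
    ∃ (b : A) (j' : b ⟶ d) (f' : b ⟶ a), IsPullback f' j' j f ∧ E.AdmissibleEpi j'
  pushout_mono {a b c : A} (i : a ⟶ b) (f : a ⟶ c) : E.AdmissibleMono i →
    ∃ (d : A) (i' : c ⟶ d) (f' : b ⟶ d), IsPushout i f f' i' ∧ E.AdmissibleMono i'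
  obscure_epi {a b c : A} (g : a ⟶ b) (f : b ⟶ c) :
    HasKernel f → E.AdmissibleEpi (g ≫ f) → E.AdmissibleEpi f
  obscure_mono {a b c : A} (f : a ⟶ b) (g : b ⟶ c) :
    HasCokernel f → E.AdmissibleMono (f ≫ g) → E.AdmissibleMono f

/-- The additive functors `G : Aᵒᵖ ⥤ Ab` such that `0 → G a'' → G a → G a'` is exact for every
`0 → a' → a → a'' → 0` in `E`. -/
def leftExact : ObjectProperty (Aᵒᵖ ⥤ AddCommGrpCat.{max u v}) := fun G ↦
  G.Additive ∧ ∀ S : ShortComplex A, E.mem S →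
    Function.Injective (G.map S.g.op) ∧ Function.Exact (G.map S.g.op) (G.map S.f.op)

/-- The abelian envelope `F` of `(A, E)`. -/
abbrev Envelope : Type (max u v + 1) := E.leftExact.FullSubcategory

/-- The Yoneda embedding `a ↦ Hom(-, a)` with values in presheaves of abelian groups. -/
def yonedaUlift : A ⥤ Aᵒᵖ ⥤ AddCommGrpCat.{max u v} := 
  preadditiveYoneda ⋙ (Functor.whiskeringRight Aᵒᵖ AddCommGrpCat.{v} AddCommGrpCat.{max u v}).obj AddCommGrpCat.uliftFunctor.{u, v}

instance : (yonedaUlift (A := A)).Full := by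
  have := (AddCommGrpCat.uliftFunctorFullyFaithful.{u, v}.whiskeringRight Aᵒᵖ).full
  unfold yonedaUlift; infer_instance
instance : (yonedaUlift (A := A)).Faithful := by
  have := (AddCommGrpCat.uliftFunctorFullyFaithful.{u, v}.whiskeringRight Aᵒᵖ).faithful
  unfold yonedaUlift; infer_instance

theorem leftExact_yonedaUlift (a : A) : E.leftExact (yonedaUlift.obj a) := by
  refine ⟨?_, fun S hS ↦ ?_⟩
  · unfold yonedaUlift; dsimp; infer_instance
  · obtain ⟨-, ⟨hc⟩⟩ := E.isKernelCokernelPair hS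
    constructor
    · rintro ⟨x⟩ ⟨y⟩ h
      have h' : S.g ≫ x = S.g ≫ y := congrArg ULift.down h
      exact congrArg ULift.up (Cofork.IsColimit.hom_ext hc h')
    · rintro ⟨x⟩
      constructor
      · intro h
        have h' : S.f ≫ x = 0 := congrArg ULift.down h
        obtain ⟨y, hy⟩ := CokernelCofork.IsColimit.desc' hc x h'
        exact ⟨⟨y⟩, congrArg ULift.up hy⟩
      · rintro ⟨⟨y⟩, h⟩
        have h' : S.g ≫ y = x := congrArg ULift.down h
        have h0 (z : S.X₃ ⟶ a) : S.f ≫ S.g ≫ z = 0 := by rw [S.zero_assoc, zero_comp]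
        exact congrArg ULift.up ((congrArg (S.f ≫ ·) h'.symm).trans (h0 y))

/-- The Quillen embedding `A ⥤ F`, `a ↦ Hom(-, a)`. -/
def quillenEmbedding : A ⥤ E.Envelope :=
  E.leftExact.lift yonedaUlift E.leftExact_yonedaUlift

instance : E.quillenEmbedding.Full := by unfold quillenEmbedding; infer_instance
instance : E.quillenEmbedding.Faithful := by unfold quillenEmbedding; infer_instance

/-- The sequences of `Ind(A)` that become short exact in `Ind(F)`, for the envelope `F`. -/
def ind : SequenceClass (Ind A) where
  mem S := IsKernelCokernelPair (S.map (indMap E.quillenEmbedding))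
  isKernelCokernelPair hS := hS.of_map _

/-- The sequences of `Pro(A)` that become short exact in `Pro(F)`, for the envelope `F`. -/
def pro : SequenceClass (Pro A) where
  mem S := IsKernelCokernelPair (S.map (proMap E.quillenEmbedding))
  isKernelCokernelPair hS := hS.of_map _

end SequenceClass

set_option linter.checkUnivs false in
/-- A preadditive category with a class of short exact sequences. -/
structure CatWithSequences where
  carrier : Type u
  [category : Category.{v} carrier]
  [preadditive : Preadditive carrier]
  seq : SequenceClass carrier

attribute [instance] CatWithSequences.category CatWithSequences.preadditive

/-- The two operations `Ind` and `Pro`. -/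
inductive Step where
  | ind
  | pro

/-- Apply `Ind` or `Pro` to a category with a class of short exact sequences. -/
noncomputable def CatWithSequences.apply (C : CatWithSequences.{v, u}) :
    Step → CatWithSequences.{v, max u (v + 1)}
  | .ind => { carrier := Ind C.carrier, seq := C.seq.ind }
  | .pro => { carrier := Pro C.carrier, seq := C.seq.pro }

/-- The iterated ind/pro-categories. The step `s` is applied first and the head of the list is
applied last: `C.iterated .pro [.ind]` is `Ind(Pro(C))`. -/
noncomputable def CatWithSequences.iterated (C : CatWithSequences.{v, u}) (s : Step) :
    List Step → CatWithSequences.{v, max u (v + 1)}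
  | [] => C.apply s
  | t :: l => (C.iterated s l).apply t

end IndPro

open IndPro

/-! A full additive subcategory of an abelian category that is closed under extensions is exact for
the sequences that become short exact there (`isExact_of_isClosedUnderExtensions`). So everything
reduces to abelian ambient categories and closure under extensions, in three steps.

The envelope `F` is abelian: sieves containing an admissible epimorphism form a topology, left exact
additive functors are its additive sheaves, and these are closed under subobjects, quotients and
finite products among all abelian sheaves.

`A` is closed under extensions in `F`: given `0 → h a → X → h c → 0`, the identity section of `h c`
lifts to `X` along some admissible epimorphism `c' → c`. Then `X` is the pushout of `h c'` along a
map from the kernel to `h a`, and that pushout already exists in `A`.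

If `A` is closed under extensions in an abelian category `B`, then `Ind(A)` is so in the abelian
category `Ind(B)` (`isClosedUnderExtensions_indMap`): an extension of `“colim” Zᵢ` by `“colim” Xₖ`
is exhausted by extensions of single `Zᵢ` by single `Xₖ`, which lie in `A`.

`Pro` is dual, since `F` is abelian and `A` closed under extensions in it also after passing to
opposites. Only exactness of the input is used, so the construction iterates. -/

namespace IndPro

/-! ### Extension-closed subcategories of abelian categories are exact. -/

section ExtensionClosed

theorem isKernelCokernelPair_iff_shortExact {D : Type u} [Category.{v} D] [Abelian D]
    (S : ShortComplex D) : IsKernelCokernelPair S ↔ S.ShortExact := by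
  constructor
  · rintro ⟨⟨hf⟩, ⟨hg⟩⟩
    have : Mono S.f := mono_of_isLimit_fork hf
    have : Epi S.g := epi_of_isColimit_cofork hg
    exact ⟨S.exact_of_f_is_kernel hf⟩
  · intro h
    exact ⟨⟨h.fIsKernel⟩, ⟨h.gIsCokernel⟩⟩

theorem IsKernelCokernelPair.op {D : Type u} [Category.{v} D] [HasZeroMorphisms D]
    {S : ShortComplex D} (h : IsKernelCokernelPair S) : IsKernelCokernelPair S.op := by
  obtain ⟨⟨hf⟩, ⟨hg⟩⟩ := h
  exact ⟨⟨CokernelCofork.IsColimit.ofπOp _ _ hg⟩, ⟨KernelFork.IsLimit.ofιOp _ _ hf⟩⟩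

theorem IsKernelCokernelPair.unop {D : Type u} [Category.{v} D] [HasZeroMorphisms D]
    {S : ShortComplex Dᵒᵖ} (h : IsKernelCokernelPair S) : IsKernelCokernelPair S.unop := by
  obtain ⟨⟨hf⟩, ⟨hg⟩⟩ := h
  exact ⟨⟨CokernelCofork.IsColimit.ofπUnop _ _ hg⟩, ⟨KernelFork.IsLimit.ofιUnop _ _ hf⟩⟩

theorem exists_lift_of_shortExact {D : Type u} [Category.{v} D] [Abelian D] {K X Y T : D}
    {k : K ⟶ X} {f : X ⟶ Y} {w : k ≫ f = 0} (h : (ShortComplex.mk k f w).ShortExact)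
    (t : T ⟶ X) (ht : t ≫ f = 0) : ∃ s : T ⟶ K, s ≫ k = t :=
  ⟨h.fIsKernel.lift (KernelFork.ofι t ht),
    h.fIsKernel.fac (KernelFork.ofι t ht) WalkingParallelPair.zero⟩

theorem exists_desc_of_shortExact {D : Type u} [Category.{v} D] [Abelian D] {K X Y T : D}
    {k : K ⟶ X} {f : X ⟶ Y} {w : k ≫ f = 0} (h : (ShortComplex.mk k f w).ShortExact)
    (t : X ⟶ T) (ht : k ≫ t = 0) : ∃ s : Y ⟶ T, f ≫ s = t :=
  ⟨h.gIsCokernel.desc (CokernelCofork.ofπ t ht),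
    h.gIsCokernel.fac (CokernelCofork.ofπ t ht) WalkingParallelPair.one⟩

theorem shortExact_of_forall_lift {D : Type u} [Category.{v} D] [Abelian D] {K X Y : D}
    {k : K ⟶ X} {f : X ⟶ Y} (w : k ≫ f = 0) [Mono k] [Epi f]
    (h : ∀ {T : D} (t : T ⟶ X), t ≫ f = 0 → ∃ s : T ⟶ K, s ≫ k = t) :
    (ShortComplex.mk k f w).ShortExact :=
  { exact := ShortComplex.exact_of_f_is_kernel _ (KernelFork.IsLimit.ofι' k w
      fun t ht => ⟨(h t ht).choose, (h t ht).choose_spec⟩)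
    mono_f := ‹_›
    epi_g := ‹_› }

/-- A short exact sequence pulls back to a short exact sequence with the same kernel. -/
theorem shortExact_of_isPullback {D : Type u} [Category.{v} D] [Abelian D] {P X Y Z K : D}
    {fst : P ⟶ X} {snd : P ⟶ Y} {f : X ⟶ Z} {g : Y ⟶ Z} (h : IsPullback fst snd f g)
    {k : K ⟶ X} {w : k ≫ f = 0} (hk : (ShortComplex.mk k f w).ShortExact) :
    (ShortComplex.mk (h.lift k 0 (by simp [w])) snd (by simp)).ShortExact := by
  have := hk.mono_f
  have := hk.epi_g
  dsimp at this
  have : Epi snd := MorphismProperty.of_isPullback (P := .epimorphisms D) h ‹_›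
  have : Mono (h.lift k 0 (by simp [w])) := by
    have : Mono (h.lift k 0 (by simp [w]) ≫ fst) := by simpa
    exact mono_of_mono _ fst
  refine shortExact_of_forall_lift _ fun {T} t ht => ?_
  obtain ⟨s, hs⟩ := exists_lift_of_shortExact hk (t ≫ fst) (by simp [h.w, reassoc_of% ht])
  exact ⟨s, h.hom_ext (by simpa using hs) (by simpa using ht.symm)⟩

/-- A short exact sequence pushes out to a short exact sequence with the same cokernel. -/
theorem shortExact_of_isPushout {D : Type u} [Category.{v} D] [Abelian D] {P X Y Z C : D}
    {f : Z ⟶ X} {g : Z ⟶ Y} {inl : X ⟶ P} {inr : Y ⟶ P} (h : IsPushout f g inl inr)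
    {c : X ⟶ C} {w : f ≫ c = 0} (hc : (ShortComplex.mk f c w).ShortExact) :
    (ShortComplex.mk inr (h.desc c 0 (by simp [w])) (by simp)).ShortExact := by
  have hs := (shortExact_of_isPullback h.op.flip hc.op).unop
  refine ShortComplex.shortExact_of_iso (S₂ := ShortComplex.mk inr (h.desc c 0 (by simp [w])) _)
    (ShortComplex.isoMk (Iso.refl Y) (Iso.refl P) (Iso.refl C) ?_ ?_) hs
  · exact (Category.id_comp _).trans (Category.comp_id _).symm
  · change 𝟙 _ ≫ h.desc c 0 _ = (h.op.flip.lift c.op 0 _).unop ≫ 𝟙 _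
    rw [Category.id_comp, Category.comp_id]
    apply h.hom_ext <;> apply Quiver.Hom.op_inj <;> simp

theorem isClosedUnderExtensions_op_essImage {B : Type u} [Category.{v} B] {D : Type u₁}
    [Category.{v₁} D] [Abelian D] (F : B ⥤ D) [F.essImage.IsClosedUnderExtensions] :
    F.op.essImage.IsClosedUnderExtensions where
  prop_X₂_of_shortExact {S} hS h₁ h₃ := by
    obtain ⟨a, ⟨ea⟩⟩ := h₁
    obtain ⟨c, ⟨ec⟩⟩ := h₃
    obtain ⟨b, ⟨e⟩⟩ := F.essImage.prop_X₂_of_shortExact hS.unop ⟨c.unop, ⟨ec.unop.symm⟩⟩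
      ⟨a.unop, ⟨ea.unop.symm⟩⟩
    exact ⟨.op b, ⟨e.op.symm⟩⟩

namespace SequenceClass

variable {B : Type u} [Category.{v} B] [Preadditive B]

/-- The opposite class of sequences. -/
def opposite (E : SequenceClass B) : SequenceClass Bᵒᵖ where
  mem S := E.mem S.unop
  isKernelCokernelPair h := (E.isKernelCokernelPair h).op

theorem admissibleEpi_op_iff (E : SequenceClass B) {a b : B} (i : a ⟶ b) :
    E.opposite.AdmissibleEpi i.op ↔ E.AdmissibleMono i :=
  ⟨fun ⟨c, j, w, h⟩ => ⟨c.unop, j.unop, congrArg Quiver.Hom.unop w, h⟩,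
    fun ⟨c, j, w, h⟩ => ⟨.op c, j.op, congrArg Quiver.Hom.op w, h⟩⟩

theorem mem_iff_shortExact {D : Type u₁} [Category.{v₁} D] [Abelian D] {E : SequenceClass B}
    {F : B ⥤ D} [F.PreservesZeroMorphisms] (hE : ∀ S, E.mem S ↔ IsKernelCokernelPair (S.map F))
    (S : ShortComplex B) : E.mem S ↔ (S.map F).ShortExact :=
  (hE S).trans (isKernelCokernelPair_iff_shortExact _)

section

variable {D : Type u₁} [Category.{v₁} D] [Abelian D] {E : SequenceClass B}
  {F : B ⥤ D} [F.Full] [F.Faithful] [F.Additive]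
  (hE : ∀ S, E.mem S ↔ IsKernelCokernelPair (S.map F))

include hE

theorem admissibleEpi_of_shortExact {b c : B} {j : b ⟶ c} {K : D} {k : K ⟶ F.obj b}
    {w : k ≫ F.map j = 0} (h : (ShortComplex.mk k (F.map j) w).ShortExact) (hK : F.essImage K) :
    E.AdmissibleEpi j := by
  obtain ⟨a, ⟨e⟩⟩ := hK
  have hw : F.map (F.preimage (e.hom ≫ k)) ≫ F.map j = 0 := by simp [w]
  refine ⟨a, F.preimage (e.hom ≫ k), F.map_injective (by simp [w]), ?_⟩
  rw [mem_iff_shortExact hE]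
  refine ShortComplex.shortExact_of_iso (S₁ := ShortComplex.mk k (F.map j) w)
    (ShortComplex.isoMk e.symm (Iso.refl (F.obj b)) (Iso.refl (F.obj c)) ?_ ?_) h
  · change e.inv ≫ F.map (F.preimage (e.hom ≫ k)) = k ≫ 𝟙 _
    simp
  · exact (Category.id_comp _).trans (Category.comp_id _).symm

variable [F.essImage.IsClosedUnderExtensions]

/-- The kernel of `f ≫ g` is the pullback of `f` along the kernel of `g`, hence an extension of `ker
g` by `ker f`. -/
theorem admissibleEpi_comp {a b c : B} (f : a ⟶ b) (g : b ⟶ c)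
    (hf : E.AdmissibleEpi f) (hg : E.AdmissibleEpi g) : E.AdmissibleEpi (f ≫ g) := by
  obtain ⟨x, i, w, hf⟩ := hf
  obtain ⟨y, l, w', hg⟩ := hg
  rw [mem_iff_shortExact hE] at hf hg
  have hP := IsPullback.of_hasPullback (F.map f) (F.map l)
  have hs := shortExact_of_isPullback hP hf
  have : Epi (F.map f) := hf.epi_g
  have : Epi (F.map g) := hg.epi_g
  have : Mono (F.map l) := hg.mono_f
  have w₁ : pullback.fst (F.map f) (F.map l) ≫ F.map (f ≫ g) = 0 := by
    rw [F.map_comp, pullback.condition_assoc, ← F.map_comp, w', F.map_zero, comp_zero]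
  refine admissibleEpi_of_shortExact hE (k := pullback.fst (F.map f) (F.map l)) (w := w₁) ?_
    (F.essImage.prop_X₂_of_shortExact hs (F.obj_mem_essImage _) (F.obj_mem_essImage _))
  have : Epi (F.map (f ≫ g)) := by rw [F.map_comp]; exact epi_comp _ _
  have : Mono (pullback.fst (F.map f) (F.map l)) := inferInstance
  refine shortExact_of_forall_lift _ fun {T} t ht => ?_
  obtain ⟨s, hs⟩ := exists_lift_of_shortExact hg (t ≫ F.map f) (by simpa using ht)
  exact ⟨pullback.lift t s hs.symm, pullback.lift_fst _ _ _⟩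

/-- The pullback in `D` is an extension of `d` by the kernel of `j`. The square is asserted to be
cartesian in `D`, which is stronger than in `B` and is what `admissibleEpi_of_comp` needs. -/
theorem admissibleEpi_pullback {a c d : B} (j : a ⟶ c) (f : d ⟶ c) (hj : E.AdmissibleEpi j) :
    ∃ (b : B) (j' : b ⟶ d) (f' : b ⟶ a), IsPullback (F.map f') (F.map j') (F.map j) (F.map f) ∧
      E.AdmissibleEpi j' := by
  obtain ⟨x, i, w, hj⟩ := hj
  rw [mem_iff_shortExact hE] at hj
  have hP := IsPullback.of_hasPullback (F.map j) (F.map f)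
  have hs := shortExact_of_isPullback hP hj
  obtain ⟨b, ⟨e⟩⟩ := F.essImage.prop_X₂_of_shortExact hs (F.obj_mem_essImage _)
    (F.obj_mem_essImage _)
  have h : IsPullback (F.map (F.preimage (e.hom ≫ pullback.fst _ _)))
      (F.map (F.preimage (e.hom ≫ pullback.snd _ _))) (F.map j) (F.map f) :=
    hP.of_iso e.symm (Iso.refl _) (Iso.refl _) (Iso.refl _) (by simp) (by simp) (by simp) (by simp)
  exact ⟨b, _, _, h, admissibleEpi_of_shortExact hE (shortExact_of_isPullback h hj)
    (F.obj_mem_essImage _)⟩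

/-- The point is that `F` preserves the kernel of `f`. This kernel is a retract of the pullback `P`
of `g ≫ f` and `f`, and both `P` and the retraction identities survive under `F`. -/
theorem admissibleEpi_of_comp {a b c : B} (g : a ⟶ b) (f : b ⟶ c) [HasKernel f]
    (hgf : E.AdmissibleEpi (g ≫ f)) : E.AdmissibleEpi f := by
  have hepi : Epi (F.map f) := by
    obtain ⟨x, i, w, h⟩ := hgf
    rw [mem_iff_shortExact hE] at h
    have : Epi (F.map (g ≫ f)) := h.epi_g
    rw [F.map_comp] at this
    exact epi_of_epi (F.map g) (F.map f)
  obtain ⟨P, p₂, p₁, hPF, -⟩ := admissibleEpi_pullback hE (g ≫ f) f hgf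
  have hP : IsPullback p₁ p₂ (g ≫ f) f := IsPullback.of_map F
    (F.map_injective (by simpa using hPF.w)) hPF
  -- `σ` splits `p₁`, so `e = 1 - p₁ ≫ σ` projects `P` onto the kernel of `p₁`, which is a copy of
  -- `kernel f`.
  let σ : a ⟶ P := hP.lift (𝟙 a) g (by simp)
  let e : P ⟶ P := 𝟙 P - p₁ ≫ σ
  have he₁ : e ≫ p₁ = 0 := by simp [e, σ]
  let t : P ⟶ kernel f := kernel.lift f (e ≫ p₂) (by
    rw [Category.assoc, ← hP.w, reassoc_of% he₁, zero_comp])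
  have ht : t ≫ kernel.ι f = e ≫ p₂ := kernel.lift_ι _ _ _
  let k : kernel f ⟶ P := hP.lift 0 (kernel.ι f) (by simp)
  have hk₁ : k ≫ p₁ = 0 := hP.lift_fst _ _ _
  have hk₂ : k ≫ p₂ = kernel.ι f := hP.lift_snd _ _ _
  have hke : k ≫ e = k := by simp [e, reassoc_of% hk₁]
  have hkt : k ≫ t = 𝟙 _ := by
    rw [← cancel_mono (kernel.ι f), Category.assoc, ht, reassoc_of% hke, hk₂, Category.id_comp]
  have w : F.map (kernel.ι f) ≫ F.map f = 0 := by
    rw [← F.map_comp, kernel.condition, F.map_zero]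
  have : Mono (F.map (kernel.ι f)) := by
    refine Preadditive.mono_of_cancel_zero _ fun {T} x hx => ?_
    have : x ≫ F.map k = 0 := hPF.hom_ext
      (by rw [Category.assoc, ← F.map_comp, hk₁, F.map_zero, comp_zero, zero_comp])
      (by rw [Category.assoc, ← F.map_comp, hk₂, hx, zero_comp])
    rw [← Category.comp_id x, ← F.map_id, ← hkt, F.map_comp, reassoc_of% this, zero_comp]
  refine admissibleEpi_of_shortExact hE (w := w)
    (shortExact_of_forall_lift _ fun {T} x hx => ?_) (F.obj_mem_essImage _)
  let y : T ⟶ F.obj P := hPF.lift 0 x (by simpa using hx.symm)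
  have hy : y ≫ F.map e = y := by
    simp [e, y]
  refine ⟨y ≫ F.map t, ?_⟩
  have : x = y ≫ F.map p₂ := (hPF.lift_snd _ _ _).symm
  rw [Category.assoc, ← F.map_comp, ht, F.map_comp, reassoc_of% hy, ← this]

end

variable {D : Type u₁} [Category.{v₁} D] [Abelian D]

/-- A full additive subcategory of an abelian category that is closed under extensions is an
exact category for the sequences that are short exact in the abelian category. -/
theorem isExact_of_isClosedUnderExtensions [HasFiniteBiproducts B] {E : SequenceClass B}
    {F : B ⥤ D} [F.Full] [F.Faithful] [F.Additive] [F.essImage.IsClosedUnderExtensions]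
    (hE : ∀ S, E.mem S ↔ IsKernelCokernelPair (S.map F)) : E.IsExact := by
  -- The axioms on monomorphisms are those on epimorphisms for `E.opposite` and `F.op`.
  have hE' : ∀ S, E.opposite.mem S ↔ IsKernelCokernelPair (S.map F.op) := fun S =>
    (hE S.unop).trans ⟨fun h => h.op, fun h => h.unop⟩
  have := isClosedUnderExtensions_op_essImage F
  exact
  { hasFiniteBiproducts := inferInstance
    of_iso := fun {S T} ⟨e⟩ hS => by
      rw [mem_iff_shortExact hE] at hS ⊢
      exact ShortComplex.shortExact_of_iso (F.mapShortComplex.mapIso e) hS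
    split := fun {a c} b ⟨hb⟩ => by
      rw [mem_iff_shortExact hE]
      have s : (ShortComplex.mk b.inl b.snd b.inl_snd).Splitting :=
        { r := b.fst, s := b.inr, id := IsBilimit.binary_total hb }
      exact (s.map F).shortExact
    comp_epi := fun f g hf hg => admissibleEpi_comp hE f g hf hg
    comp_mono := fun f g hf hg => by
      rw [← admissibleEpi_op_iff] at hf hg ⊢
      exact admissibleEpi_comp hE' _ _ hg hf
    pullback_epi := fun j f hj => by
      obtain ⟨b, j', f', h, hj'⟩ := admissibleEpi_pullback hE j f hj
      exact ⟨b, j', f', .of_map F (F.map_injective (by simpa using h.w)) h, hj'⟩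
    pushout_mono := fun i f hi => by
      rw [← admissibleEpi_op_iff] at hi
      obtain ⟨b, j', f', h, hj'⟩ := admissibleEpi_pullback hE' _ f.op hi
      have := IsPullback.of_map F.op (F.op.map_injective (by simpa using h.w)) h
      refine ⟨b.unop, j'.unop, f'.unop, this.unop.flip, ?_⟩
      rwa [← admissibleEpi_op_iff]
    obscure_epi := fun g f _ h => admissibleEpi_of_comp hE g f h
    obscure_mono := fun f g _ h => by
      have : HasKernel f.op :=
        ⟨⟨_, CokernelCofork.IsColimit.ofπOp _ (cokernel.condition f) (cokernelIsCokernel f)⟩⟩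
      rw [← admissibleEpi_op_iff] at h ⊢
      exact admissibleEpi_of_comp hE' g.op f.op h }

end SequenceClass

end ExtensionClosed

end IndPro

/-! ### Ind-objects of an abelian category form an abelian category. -/

namespace IndPro

section IndAbelian

instance {B : Type u} [Category.{v} B] [Preadditive B] [HasFiniteBiproducts B] :
    HasFiniteBiproducts (Ind B) := by
  have : HasFiniteProducts (Ind B) :=
    ⟨fun n => hasLimitsOfShape_of_equivalence (Discrete.equivalence (Equiv.ulift.{v} (α := Fin n)))⟩
  exact HasFiniteBiproducts.of_hasFiniteProducts

/-- With binary biproducts the preadditive structure is unique, so the one transported along `F` is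
the given one. -/
theorem additive_of_fullyFaithful {B : Type u} [Category.{v} B] [Preadditive B]
    [HasBinaryBiproducts B] {D : Type u₁} [Category.{v₁} D] [Preadditive D] (F : B ⥤ D) [F.Full]
    [F.Faithful] : F.Additive := by
  have h : (inferInstance : Preadditive B) = .ofFullyFaithful (.ofFullyFaithful F) :=
    Subsingleton.elim _ _
  refine ⟨fun {X Y f g} => ?_⟩
  exact (congrArg (fun p : Preadditive B => F.map ((p.homGroup X Y).add f g)) h).trans
    ((Functor.FullyFaithful.ofFullyFaithful F).map_preimage _)

instance {B : Type u} [Category.{v} B] [Preadditive B] [HasBinaryBiproducts B] :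
    (Ind.yoneda (C := B)).Additive :=
  additive_of_fullyFaithful _

variable {B : Type u} [Category.{v} B] [Abelian B]

/-- Up to isomorphism `f` is `Ind.lim I` of a morphism of `I ⥤ B`. That functor is compatible with
the coimage-image comparison, which is an isomorphism in the abelian category `I ⥤ B`. -/
theorem isIso_coimageImageComparison_ind {X Y : Ind B} (f : X ⟶ Y) :
    IsIso (Abelian.coimageImageComparison f) := by
  obtain ⟨I, _, _, F, G, ϕ, ⟨i⟩⟩ := Ind.exists_nonempty_arrow_mk_iso_ind_lim (f := f)
  have : HasZeroObject (Ind B) := hasZeroObject_of_hasTerminal_object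
  have : HasZeroObject (I ⥤ B) := inferInstance
  have : (Ind.lim (C := B) I).PreservesZeroMorphisms := inferInstance
  let i' : Arrow.mk (Abelian.coimageImageComparison f) ≅
      Arrow.mk (Abelian.coimageImageComparison ((Ind.lim I).map ϕ)) :=
    Abelian.coimageImageComparisonFunctor.mapIso i
  have := Iso.isIso_hom i'
  rw [Arrow.isIso_iff_isIso_of_isIso i'.hom,
    Arrow.isIso_iff_isIso_of_isIso (Abelian.PreservesCoimageImageComparison.iso (Ind.lim I) ϕ).inv]
  infer_instance

/-- The category of ind-objects of an abelian category is abelian. -/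
noncomputable instance indAbelian : Abelian (Ind B) :=
  have := @isIso_coimageImageComparison_ind B _ _
  .ofCoimageImageComparisonIsIso

end IndAbelian

end IndPro

/-! ### A criterion for an ind-object of `B` to come from `A`. -/

namespace IndPro

section EssImage

variable {A : Type u} [Category.{v} A] {B : Type u₁} [Category.{max u v} B]

theorem mem_essImage_indMap_of_iso (h : A ⥤ B) {Y : Ind B} {X : Aᵒᵖ ⥤ Type v}
    (hX : IsIndObject X) (e : (presheafMap h).obj X ≅ (Ind.inclusion B).obj Y) :
    (indMap h).essImage Y :=
  ⟨(Ind.equivalence A).inverse.obj ⟨X, hX⟩, ⟨(Ind.inclusion.fullyFaithful (C := B)).preimageIso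
    ((indMapInclusion h).app _ ≪≫ (presheafMap h).mapIso
      ((ObjectProperty.ι _).mapIso ((Ind.equivalence A).counitIso.app ⟨X, hX⟩)) ≪≫ e)⟩⟩

open IsFiltered.SmallFilteredIntermediate in
/-- An ind-object `Y` of `B` comes from `A` if a `v`-small family of maps to `Y` from objects of `A`
is such that every map from an object of `B` to `Y` factors through a member of the family. -/
theorem mem_essImage_indMap (h : A ⥤ B) [h.Full] [h.Faithful] {Y : Ind B} {ι : Type v}
    (y : ι → A) (p : ∀ i, Ind.yoneda.obj (h.obj (y i)) ⟶ Y)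
    (H : ∀ (b : B) (t : Ind.yoneda.obj b ⟶ Y),
      ∃ (i : ι) (g : b ⟶ h.obj (y i)), Ind.yoneda.map g ≫ p i = t) :
    (indMap h).essImage Y := by
  let α := Ind.yonedaCompInclusion (C := B)
  let p' (i : ι) : yoneda.obj (h.obj (y i)) ⟶ (Ind.inclusion B).obj Y :=
    α.inv.app _ ≫ (Ind.inclusion B).map (p i)
  replace H (b : B) (t : yoneda.obj b ⟶ (Ind.inclusion B).obj Y) :
      ∃ (i : ι) (g : b ⟶ h.obj (y i)), yoneda.map g ≫ p' i = t := by
    obtain ⟨i, g, hg⟩ := H b ((Ind.inclusion B).preimage (α.hom.app b ≫ t))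
    refine ⟨i, g, ?_⟩
    have h₁ := congrArg (fun x => α.inv.app b ≫ (Ind.inclusion B).map x) hg
    have h₂ := α.inv.naturality_assoc g ((Ind.inclusion B).map (p i))
    simp only [Functor.map_comp, Functor.map_preimage, Iso.inv_hom_id_app_assoc] at h₁
    exact h₂.trans h₁
  let Y' := (Ind.inclusion B).obj Y
  -- By `H`, objects of `A` over `Y'` are cofinal among all objects of `B` over `Y'`, so `Y'` is the
  -- filtered colimit over `K`. What remains is to replace `K` by a `v`-small filtered category.
  let K := CostructuredArrow (h ⋙ yoneda) Y'
  let pre : K ⥤ CostructuredArrow yoneda Y' := CostructuredArrow.pre h yoneda Y'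
  have : IsFiltered (CostructuredArrow yoneda Y') := Y.isIndObject_inclusion_obj.isFiltered
  have H' (d : CostructuredArrow yoneda Y') :
      ∃ i, Nonempty (d ⟶ pre.obj (CostructuredArrow.mk (S := h ⋙ yoneda) (p' i))) := by
    obtain ⟨i, g, hg⟩ := H d.left d.hom
    exact ⟨i, ⟨CostructuredArrow.homMk g hg⟩⟩
  have H'' (d : CostructuredArrow yoneda Y') : ∃ c, Nonempty (d ⟶ pre.obj c) :=
    (H' d).imp' _ fun _ => id
  have : pre.Full := inferInstanceAs (CostructuredArrow.pre h yoneda Y').Full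
  have : pre.Faithful := inferInstanceAs (CostructuredArrow.pre h yoneda Y').Faithful
  have : IsFiltered K := .of_exists_of_isFiltered_of_fullyFaithful pre H''
  have : pre.Final := Functor.final_of_exists_of_isFiltered_of_fullyFaithful pre H''
  have : FinallySmall.{v} K := by
    refine finallySmall_of_small_weakly_terminal_set
      (Set.range fun i => CostructuredArrow.mk (S := h ⋙ yoneda) (p' i)) fun k => ?_
    obtain ⟨i, ⟨g⟩⟩ := H' (pre.obj k)
    exact ⟨_, ⟨i, rfl⟩, ⟨pre.preimage g⟩⟩
  -- A small final model need not be filtered. It is mapped into a small filtered intermediate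
  -- category, whose fully faithful inclusion in `K` is then final too.
  have : (factoring (fromFinalModel K) ⋙ inclusion (fromFinalModel K)).Final :=
    Functor.final_of_natIso (factoringCompInclusion (fromFinalModel K)).symm
  have : (inclusion (fromFinalModel K)).Final :=
    Functor.final_of_comp_full_faithful' (factoring _) (inclusion _)
  have : Nonempty (FinalModel K) := Nonempty.map
    (Functor.Final.lift (fromFinalModel K)) IsFiltered.nonempty
  let G := inclusion (fromFinalModel K) ⋙ CostructuredArrow.proj (h ⋙ yoneda) Y'
  let c := (Presheaf.tautologicalCocone Y').whisker (inclusion (fromFinalModel K) ⋙ pre)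
  let hc : IsColimit c := (Functor.Final.isColimitWhiskerEquiv _ _).symm
    (Presheaf.isColimitTautologicalCocone Y')
  refine mem_essImage_indMap_of_iso h (X := colimit (G ⋙ yoneda))
    ⟨⟨_, G, _, colimit.isColimit (G ⋙ yoneda)⟩⟩ ?_
  exact (isColimitOfPreserves (presheafMap h)
    (colimit.isColimit (G ⋙ yoneda))).coconePointsIsoOfNatIso hc
      (Functor.isoWhiskerLeft G (presheafMapYoneda h))

end EssImage

end IndPro

/-! ### Extensions of ind-objects. -/

namespace IndPro

section IndExtensions

/-- The Yoneda lemma for ind-objects. -/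
noncomputable def indYonedaEquiv {B : Type u} [Category.{v} B] (b : B) (X : Ind B) :
    (Ind.yoneda.obj b ⟶ X) ≃ ((Ind.inclusion B).obj X).obj (op b) :=
  (Ind.inclusion.fullyFaithful.homEquiv.trans
    ((Ind.yonedaCompInclusion.app b).homFromEquiv)).trans yonedaEquiv

theorem indYonedaEquiv_comp {B : Type u} [Category.{v} B] {b : B} {X Y : Ind B}
    (t : Ind.yoneda.obj b ⟶ X) (f : X ⟶ Y) :
    indYonedaEquiv b Y (t ≫ f) = ((Ind.inclusion B).map f).app (op b) (indYonedaEquiv b X t) := by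
  simp [indYonedaEquiv, yonedaEquiv, Functor.FullyFaithful.homEquiv]

/-- The colimit is required after `Ind.inclusion`, where it is computed pointwise; evaluating at `b`
gives the factorization. -/
theorem exists_fac_of_isColimit {B : Type u₁} [Category.{max u v} B] {K : Type v}
    [SmallCategory K] [IsFiltered K] {G : K ⥤ B} {c : Cocone (G ⋙ Ind.yoneda)}
    (hc : IsColimit ((Ind.inclusion B).mapCocone c)) {b : B} (t : Ind.yoneda.obj b ⟶ c.pt) :
    ∃ (k : K) (s : b ⟶ G.obj k), Ind.yoneda.map s ≫ c.ι.app k = t := by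
  obtain ⟨k, s, hs⟩ := Types.jointly_surjective_of_isColimit
    (isColimitOfPreserves ((evaluation _ _).obj (op b)) hc) (indYonedaEquiv b c.pt t)
  refine ⟨k, Ind.yoneda.preimage ((indYonedaEquiv b _).symm s), ?_⟩
  apply (indYonedaEquiv b c.pt).injective
  rw [indYonedaEquiv_comp, ← hs, Functor.map_preimage]
  exact congrArg _ (Equiv.apply_symm_apply _ _)

theorem exists_map_eq_of_isColimit {B : Type u₁} [Category.{max u v} B] {K : Type v}
    [SmallCategory K] [IsFiltered K] {G : K ⥤ B} {c : Cocone (G ⋙ Ind.yoneda)}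
    (hc : IsColimit ((Ind.inclusion B).mapCocone c)) {b : B} {k : K} {s s' : b ⟶ G.obj k}
    (hs : Ind.yoneda.map s ≫ c.ι.app k = Ind.yoneda.map s' ≫ c.ι.app k) :
    ∃ (k' : K) (g : k ⟶ k'), s ≫ G.map g = s' ≫ G.map g := by
  have h := congrArg (indYonedaEquiv b c.pt) hs
  rw [indYonedaEquiv_comp, indYonedaEquiv_comp] at h
  obtain ⟨k', g, hg⟩ := (Types.FilteredColimit.isColimit_eq_iff'
    (isColimitOfPreserves ((evaluation _ _).obj (op b)) hc) _ _).1 h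
  refine ⟨k', g, Ind.yoneda.map_injective ((indYonedaEquiv b _).injective ?_)⟩
  rw [Functor.map_comp, Functor.map_comp, indYonedaEquiv_comp, indYonedaEquiv_comp]
  exact hg

theorem exists_isColimit_mapCocone_of_iso {C : Type*} [Category* C] {D : Type*} [Category* D]
    (F : C ⥤ D) [F.Full] [F.Faithful] {K : Type*} [Category* K] {G : K ⥤ C} {d : Cocone (G ⋙ F)}
    (hd : IsColimit d) {X : C} (e : d.pt ≅ F.obj X) :
    ∃ a : G ⟶ (Functor.const K).obj X, Nonempty (IsColimit (F.mapCocone ⟨X, a⟩)) := by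
  refine ⟨{ app k := F.preimage (d.ι.app k ≫ e.hom), naturality k k' g := F.map_injective ?_ }, ⟨?_⟩⟩
  · have := d.w g
    dsimp at this
    simp [reassoc_of% this]
  · exact hd.ofIsoColimit (Cocone.ext e)

theorem exists_cocone_of_mem_essImage {A : Type u} [Category.{v} A] {B : Type u₁}
    [Category.{max u v} B] (h : A ⥤ B) {X : Ind B} (hX : (indMap h).essImage X) :
    ∃ (K : Type v) (_ : SmallCategory K) (_ : IsFiltered K) (P : K ⥤ A)
      (a : (P ⋙ h) ⋙ Ind.yoneda ⟶ (Functor.const K).obj X),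
      Nonempty (IsColimit ((Ind.inclusion B).mapCocone ⟨X, a⟩)) := by
  obtain ⟨X₀, ⟨e⟩⟩ := hX
  let P := X₀.presentation
  let i : ((P.F ⋙ h) ⋙ Ind.yoneda) ⋙ Ind.inclusion B ≅ (P.F ⋙ yoneda) ⋙ presheafMap h :=
    Functor.isoWhiskerLeft (P.F ⋙ h) Ind.yonedaCompInclusion ≪≫
      Functor.isoWhiskerLeft P.F (presheafMapYoneda h).symm
  exact ⟨P.I, inferInstance, inferInstance, P.F, exists_isColimit_mapCocone_of_iso _
    ((IsColimit.precomposeHomEquiv i _).symm (isColimitOfPreserves (presheafMap h) P.isColimit))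
    (((indMapInclusion h).app X₀).symm ≪≫ (Ind.inclusion B).mapIso e)⟩

/-- An epimorphism from an ind-object to an object of `B` is already an epimorphism on an object
of `B` that maps to the ind-object. -/
theorem exists_epi_of_epi {B : Type u} [Category.{v} B] [Abelian B] {Y : Ind B} {c : B}
    (q : Y ⟶ Ind.yoneda.obj c) [Epi q] :
    ∃ (b : B) (t : Ind.yoneda.obj b ⟶ Y) (e : b ⟶ c), Epi e ∧ t ≫ q = Ind.yoneda.map e := by
  let P := Y.presentation
  obtain ⟨a, ⟨ha⟩⟩ := exists_isColimit_mapCocone_of_iso (Ind.inclusion B) (G := P.F ⋙ Ind.yoneda)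
    ((IsColimit.precomposeHomEquiv (Functor.isoWhiskerLeft P.F Ind.yonedaCompInclusion) _).symm
      P.isColimit) (Iso.refl _)
  let p (k : P.I) : P.F.obj k ⟶ c := Ind.yoneda.preimage (a.app k ≫ q)
  have hp {k k' : P.I} (g : k ⟶ k') : P.F.map g ≫ p k' = p k := Ind.yoneda.map_injective (by
    have := a.naturality g
    dsimp at this
    simp [p, reassoc_of% this])
  let Q : P.I ⥤ B :=
    { obj k := cokernel (p k)
      map {k k'} g := cokernel.desc _ (cokernel.π (p k'))
        (by rw [← hp g, Category.assoc, cokernel.condition, comp_zero]) }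
  have hQ {k k' : P.I} (g : k ⟶ k') : cokernel.π (p k) ≫ Q.map g = cokernel.π (p k') :=
    cokernel.π_desc _ _ _
  -- The `r k` all coincide and are killed by the epimorphism `q`, so they vanish. Vanishing in a
  -- filtered colimit occurs at some stage `k`, and there `cokernel (p k)` is zero.
  let r (k : P.I) : Ind.yoneda.obj c ⟶ colimit (Q ⋙ Ind.yoneda) :=
    Ind.yoneda.map (cokernel.π (p k)) ≫ colimit.ι (Q ⋙ Ind.yoneda) k
  have hr {k k' : P.I} (g : k ⟶ k') : r k = r k' := by
    have := colimit.w (Q ⋙ Ind.yoneda) g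
    dsimp at this
    dsimp only [r]
    rw [← this, ← hQ g, Functor.map_comp, Category.assoc]
  have hr' (k k' : P.I) : r k = r k' :=
    (hr (IsFiltered.leftToMax k k')).trans (hr (IsFiltered.rightToMax k k')).symm
  obtain ⟨k₀⟩ : Nonempty P.I := IsFiltered.nonempty
  have h₀ : q ≫ r k₀ = 0 := by
    refine (isColimitOfReflects (Ind.inclusion B) ha).hom_ext fun k => ?_
    have h₁ : Ind.yoneda.map (p k) = a.app k ≫ q := Ind.yoneda.map_preimage _
    dsimp only
    rw [hr' k₀ k, comp_zero, ← Category.assoc, ← h₁, ← Functor.map_comp_assoc, cokernel.condition,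
      Functor.map_zero, zero_comp]
  rw [← comp_zero (f := q), cancel_epi] at h₀
  obtain ⟨k, g, hg⟩ := exists_map_eq_of_isColimit.{v, v}
    (isColimitOfPreserves (Ind.inclusion B) (colimit.isColimit (Q ⋙ Ind.yoneda)))
    (s := cokernel.π (p k₀)) (s' := 0) (by simpa using h₀)
  rw [hQ, zero_comp] at hg
  exact ⟨_, a.app k, p k, Preadditive.epi_of_cokernel_zero hg, (Ind.yoneda.map_preimage _).symm⟩

variable {A : Type u} [Category.{v} A] {B : Type u₁} [Category.{max u v} B] [Abelian B]

/-- If `A` is closed under extensions in the abelian category `B`, then `Ind(A)` is closed under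
extensions in `Ind(B)`. -/
theorem isClosedUnderExtensions_indMap (h : A ⥤ B) [h.Full] [h.Faithful]
    [h.essImage.IsClosedUnderExtensions] : (indMap h).essImage.IsClosedUnderExtensions := by
  refine ⟨fun {S} hS hX hZ => ?_⟩
  obtain @⟨X, Y, Z, f, q, w⟩ := S
  obtain ⟨KX, _, _, PX, a, ⟨ha⟩⟩ := exists_cocone_of_mem_essImage h hX
  obtain ⟨KZ, _, _, PZ, z, ⟨hz⟩⟩ := exists_cocone_of_mem_essImage h hZ
  dsimp only at PX PZ a z ha hz f q
  have : Mono f := hS.mono_f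
  have : Epi q := hS.epi_g
  -- Each `Zᵢ → Z` lifts to `Y` after an epimorphism `e : b → Zᵢ` of `B`. On `kernel e` the lift
  -- lands in `X`, hence factors through a single `Xₖ`.
  have lift (i : KZ) : ∃ (b : B) (e : b ⟶ h.obj (PZ.obj i)) (u : Ind.yoneda.obj b ⟶ Y) (k : KX)
      (φ : kernel e ⟶ h.obj (PX.obj k)), Epi e ∧ u ≫ q = Ind.yoneda.map e ≫ z.app i ∧
        Ind.yoneda.map φ ≫ a.app k ≫ f = Ind.yoneda.map (kernel.ι e) ≫ u := by
    obtain ⟨b, t, e, he, ht⟩ := exists_epi_of_epi (c := h.obj (PZ.obj i)) (pullback.snd q (z.app i))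
    have hu : (t ≫ pullback.fst q (z.app i)) ≫ q = Ind.yoneda.map e ≫ z.app i := by
      rw [Category.assoc, pullback.condition, reassoc_of% ht]
    obtain ⟨m, hm⟩ := exists_lift_of_shortExact hS
      (Ind.yoneda.map (kernel.ι e) ≫ t ≫ pullback.fst q (z.app i)) (by
        rw [Category.assoc, hu, ← Functor.map_comp_assoc, kernel.condition, Functor.map_zero,
          zero_comp])
    obtain ⟨k, φ, hφ⟩ := exists_fac_of_isColimit.{v, u} ha m
    exact ⟨b, e, _, k, φ, he, hu, by rw [reassoc_of% hφ, hm]⟩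
  choose b e u k₀ φ he hu hφ using lift
  -- For fixed `i`, every stage beyond `k₀ i` must be allowed, since the factorization below
  -- enlarges `k`. The family is still `v`-small.
  let ι := Σ i : KZ, Σ k : KX, (k₀ i ⟶ k)
  let ψ (x : ι) : kernel (e x.1) ⟶ h.obj (PX.obj x.2.1) := φ x.1 ≫ h.map (PX.map x.2.2)
  have hy (x : ι) : h.essImage (pushout (kernel.ι (e x.1)) (ψ x)) :=
    h.essImage.prop_X₂_of_shortExact (shortExact_of_isPushout
      (IsPushout.of_hasPushout (kernel.ι (e x.1)) (ψ x)) (c := e x.1) (w := kernel.condition _)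
      (shortExact_of_forall_lift _ fun t ht => ⟨kernel.lift _ t ht, kernel.lift_ι _ _ _⟩))
      (h.obj_mem_essImage _) (h.obj_mem_essImage _)
  choose y ey using hy
  have hp (x : ι) : ∃ p : Ind.yoneda.obj (pushout (kernel.ι (e x.1)) (ψ x)) ⟶ Y,
      Ind.yoneda.map (pushout.inl _ _) ≫ p = u x.1 ∧
      Ind.yoneda.map (pushout.inr _ _) ≫ p = a.app x.2.1 ≫ f := by
    have hP := (IsPushout.of_hasPushout (kernel.ι (e x.1)) (ψ x)).map Ind.yoneda
    have hw : Ind.yoneda.map (kernel.ι (e x.1)) ≫ u x.1 =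
        Ind.yoneda.map (ψ x) ≫ a.app x.2.1 ≫ f := by
      have := a.naturality x.2.2
      dsimp at this
      rw [← hφ, Functor.map_comp_assoc, reassoc_of% this]
    exact ⟨hP.desc _ _ hw, hP.inl_desc _ _ _, hP.inr_desc _ _ _⟩
  choose p hp₁ hp₂ using hp
  refine mem_essImage_indMap h y (fun x => Ind.yoneda.map (ey x).some.hom ≫ p x) fun c t => ?_
  suffices ∃ (x : ι) (d : c ⟶ pushout (kernel.ι (e x.1)) (ψ x)), Ind.yoneda.map d ≫ p x = t by
    obtain ⟨x, d, hd⟩ := this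
    exact ⟨x, d ≫ (ey x).some.inv, by simpa [← Functor.map_comp_assoc] using hd⟩
  obtain ⟨i, s, hs⟩ := exists_fac_of_isColimit.{v, u} hz (t ≫ q)
  have hP := (IsPullback.of_hasPullback s (e i)).flip
  -- On the pullback of `e i` along `s`, both `t` and `u i` lift the same map to `Z`, so their
  -- difference comes from `X`.
  obtain ⟨n, hn⟩ := exists_lift_of_shortExact hS (Ind.yoneda.map (pullback.fst s (e i)) ≫ t -
      Ind.yoneda.map (pullback.snd s (e i)) ≫ u i) (by
    dsimp at hs
    rw [Preadditive.sub_comp, Category.assoc, Category.assoc, hu, ← hs, ← Functor.map_comp_assoc,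
      ← Functor.map_comp_assoc, pullback.condition, sub_self])
  obtain ⟨k₁, w₁, hw₁⟩ := exists_fac_of_isColimit.{v, u} ha n
  have hj := shortExact_of_isPullback hP (k := kernel.ι (e i)) (w := kernel.condition _)
    (shortExact_of_forall_lift _ fun t ht => ⟨kernel.lift _ t ht, kernel.lift_ι _ _ _⟩)
  let j : kernel (e i) ⟶ pullback s (e i) := hP.lift (kernel.ι (e i)) 0 (by simp)
  have hj₁ : j ≫ pullback.fst s (e i) = 0 := hP.lift_snd _ _ _
  have hj₂ : j ≫ pullback.snd s (e i) = kernel.ι (e i) := hP.lift_fst _ _ _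
  have key : Ind.yoneda.map (j ≫ w₁) ≫ a.app k₁ = - (Ind.yoneda.map (φ i) ≫ a.app (k₀ i)) := by
    rw [← cancel_mono f, Preadditive.neg_comp, Category.assoc, Category.assoc, hφ,
      Functor.map_comp_assoc]
    dsimp at hw₁
    rw [reassoc_of% hw₁, hn, Preadditive.comp_sub, ← Functor.map_comp_assoc,
      ← Functor.map_comp_assoc, hj₁, hj₂, Functor.map_zero, zero_comp, zero_sub]
  let k₂ := IsFiltered.max (k₀ i) k₁
  let g₀ : k₀ i ⟶ k₂ := IsFiltered.leftToMax _ _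
  let g₁ : k₁ ⟶ k₂ := IsFiltered.rightToMax _ _
  have nat {k k' : KX} (g : k ⟶ k') : Ind.yoneda.map (h.map (PX.map g)) ≫ a.app k' = a.app k :=
    (a.naturality g).trans (Category.comp_id _)
  -- The identity `key` holds only in the colimit `X`; at the later stage `k₃` it holds in `B`. This
  -- makes the map from the pullback to the pushout vanish on the kernel of `pullback.fst`, so that
  -- it descends to `c`.
  obtain ⟨k₃, g₂, hg₂⟩ := exists_map_eq_of_isColimit.{v, u} ha (k := k₂)
    (s := (j ≫ w₁) ≫ h.map (PX.map g₁)) (s' := - (φ i ≫ h.map (PX.map g₀))) (by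
      dsimp only
      rw [Functor.map_neg, Preadditive.neg_comp, Functor.map_comp, Functor.map_comp (f := φ i),
        Category.assoc, Category.assoc, nat, nat, key])
  dsimp at hg₂
  let x : ι := ⟨i, k₃, g₀ ≫ g₂⟩
  let w' : pullback s (e i) ⟶ h.obj (PX.obj k₃) := w₁ ≫ h.map (PX.map (g₁ ≫ g₂))
  have hw' : j ≫ w' = - ψ x := by
    simpa [w', ψ, x] using hg₂
  obtain ⟨d, hd⟩ := exists_desc_of_shortExact hj (pullback.snd s (e i) ≫ pushout.inl _ _ +
      w' ≫ pushout.inr (kernel.ι (e i)) (ψ x)) (by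
    change j ≫ _ = 0
    rw [Preadditive.comp_add, reassoc_of% hj₂, reassoc_of% hw', Preadditive.neg_comp]
    exact add_neg_eq_zero.2 pushout.condition)
  have : Epi (pullback.fst s (e i)) := hj.epi_g
  refine ⟨x, d, ?_⟩
  rw [← cancel_epi (Ind.yoneda.map (pullback.fst s (e i))), ← Functor.map_comp_assoc, hd,
    Functor.map_add, Preadditive.add_comp, Functor.map_comp_assoc, Functor.map_comp_assoc]
  have h₁ := hp₁ x
  have h₂ := hp₂ x
  dsimp only [x] at h₁ h₂ ⊢
  rw [h₁, h₂]
  have h₃ : Ind.yoneda.map w' ≫ a.app k₃ = n := by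
    rw [Functor.map_comp, Category.assoc, nat]
    exact hw₁
  rw [reassoc_of% h₃, hn, add_sub_cancel]

end IndExtensions

end IndPro

/-! ### The abelian envelope as a category of additive sheaves. -/

namespace IndPro

theorem additive_of_jointly_mono {A : Type*} [Category* A] [Preadditive A] {B : Type*} [Category* B]
    [Preadditive B] {G : A ⥤ B} {ι : Type*} {H : ι → A ⥤ B} [∀ i, (H i).Additive]
    (φ : ∀ i, G ⟶ H i)
    (hφ : ∀ {a : A} {T : B} (x y : T ⟶ G.obj a), (∀ i, x ≫ (φ i).app a = y ≫ (φ i).app a) → x = y) :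
    G.Additive where
  map_add {a b f g} := hφ _ _ fun i => by simp [Functor.map_add]

namespace SequenceClass

variable {A : Type u} [Category.{v} A] [Preadditive A] {E : SequenceClass A} (hE : E.IsExact)

include hE in
theorem IsExact.admissibleEpi_id (a : A) : E.AdmissibleEpi (𝟙 a) := by
  have := hE.hasFiniteBiproducts
  have : HasZeroObject A := hasZeroObject_of_hasTerminal_object
  let b : BinaryBicone (⊤_ A) a :=
    { pt := a, fst := 0, snd := 𝟙 a, inl := 0, inr := 𝟙 a
      inl_fst := terminalIsTerminal.hom_ext _ _ }
  refine ⟨⊤_ A, _, _, hE.split b ⟨isBinaryBilimitOfTotal b ?_⟩⟩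
  simp [b]

/-- The topology whose covering sieves are those containing an admissible epimorphism. -/
def IsExact.topology : GrothendieckTopology A where
  sieves c := {S | ∃ (b : A) (j : b ⟶ c), E.AdmissibleEpi j ∧ S j}
  top_mem' c := ⟨c, 𝟙 c, hE.admissibleEpi_id c, trivial⟩
  pullback_stable' c d S f := by
    rintro ⟨b, j, hj, hS⟩
    obtain ⟨b', j', f', h, hj'⟩ := hE.pullback_epi j f hj
    refine ⟨b', j', hj', ?_⟩
    rw [Sieve.pullback_apply, ← h.w]
    exact S.downward_closed hS f'
  transitive' c S := by
    rintro ⟨b, j, hj, hS⟩ R hR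
    obtain ⟨b', j', hj', hR'⟩ := hR hS
    exact ⟨b', j' ≫ j, hE.comp_epi _ _ hj' hj, hR'⟩

/-- Two maps equalized by an admissible epimorphism `j` differ by a map through its kernel `i`. As
`G` is additive, a section is therefore compatible for the cover `j` exactly when `G(i)` kills it.
-/
theorem IsExact.leftExact_iff_isSheaf (G : Aᵒᵖ ⥤ AddCommGrpCat.{max u v}) [G.Additive] :
    E.leftExact G ↔ Presheaf.IsSheaf hE.topology G := by
  rw [Presheaf.isSheaf_iff_isSheaf_forget hE.topology G (forget AddCommGrpCat.{max u v}),
    isSheaf_iff_isSheaf_of_type]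
  have comp {a b c : A} (f : a ⟶ b) (g : b ⟶ c) (x : G.obj (op c)) :
      G.map (f ≫ g).op x = G.map f.op (G.map g.op x) := by simp
  constructor
  · rintro ⟨-, h⟩ c S ⟨b, j, ⟨a, i, w, hm⟩, hS⟩ x hx
    obtain ⟨hinj, hex⟩ := h _ hm
    have hi : G.map i.op (x j hS) = 0 := by
      have := hx i 0 hS hS (by simp [w])
      refine this.trans ?_
      simp
    obtain ⟨t, ht⟩ := (hex _).1 hi
    refine ⟨t, fun d g hg => ?_, fun t' ht' => hinj ((ht' j hS).trans ht.symm)⟩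
    -- The section is glued from `j` alone; its value on any other `g` in the sieve is checked on
    -- the pullback of `j` along `g`.
    obtain ⟨b', j', f', h', ⟨a', i', w', hm'⟩⟩ := hE.pullback_epi j g ⟨a, i, w, hm⟩
    refine (h _ hm').1 ?_
    have h₁ : G.map j'.op (x g hg) = G.map f'.op (x j hS) := hx j' f' hg hS h'.w.symm
    refine Eq.trans ?_ h₁.symm
    change G.map j'.op (G.map g.op t) = _
    rw [← comp, ← h'.w, comp]
    exact congrArg _ ht
  · intro h
    refine ⟨inferInstance, fun S hm => ?_⟩
    have hs : Presieve.IsSheafFor (G ⋙ forget AddCommGrpCat.{max u v}) (Presieve.singleton S.g) := by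
      rw [Presieve.isSheafFor_iff_generate]
      exact h _ ⟨_, S.g, ⟨_, _, _, hm⟩, Sieve.le_generate _ _ _ (Presieve.singleton_self _)⟩
    refine ⟨Presieve.isSeparatedFor_singleton.1 hs.isSeparatedFor, fun x => ⟨fun hx => ?_, ?_⟩⟩
    · refine (Presieve.isSheafFor_singleton.1 hs x fun {Z} p₁ p₂ hp => ?_).exists
      obtain ⟨⟨hl⟩, -⟩ := E.isKernelCokernelPair hm
      obtain ⟨l, hl⟩ := KernelFork.IsLimit.lift' hl (p₁ - p₂) (by simp [hp])
      have h₁ : p₁ = l ≫ S.f + p₂ := by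
        rw [← sub_eq_iff_eq_add]; exact hl.symm
      change G.map p₁.op x = G.map p₂.op x
      rw [h₁, op_add, G.map_add]
      change G.map (l ≫ S.f).op x + _ = _
      rw [comp, hx, map_zero, zero_add]
    · rintro ⟨y, rfl⟩
      rw [← comp, S.zero]
      simp

theorem IsExact.injective_map_of_admissibleEpi (G : Sheaf hE.topology AddCommGrpCat.{max u v})
    {b c : A} {j : b ⟶ c} (hj : E.AdmissibleEpi j) : Function.Injective (G.obj.map j.op) := by
  have h := (isSheaf_iff_isSheaf_of_type _ _).1
    ((Presheaf.isSheaf_iff_isSheaf_forget hE.topology G.obj (forget AddCommGrpCat.{max u v})).1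
      G.property)
  refine Presieve.isSeparatedFor_singleton.1 (Presieve.isSeparatedFor_iff_generate.2
    (h _ ⟨_, j, hj, Sieve.le_generate _ _ _ (Presieve.singleton_self _)⟩).isSeparatedFor)

/-- The additive sheaves of abelian groups. -/
def IsExact.additiveSheaf : ObjectProperty (Sheaf hE.topology AddCommGrpCat.{max u v}) :=
  fun G => G.obj.Additive

instance : hE.additiveSheaf.IsClosedUnderSubobjects where
  prop_of_mono {G H} f hf h := by
    have : H.obj.Additive := h
    have : Mono f.hom := inferInstanceAs (Mono ((sheafToPresheaf _ _).map f))
    exact additive_of_jointly_mono (ι := Unit) (fun _ => f.hom) fun x y hxy =>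
      (cancel_mono _).1 (hxy ())

theorem IsExact.exists_admissibleEpi_of_epi {G H : Sheaf hE.topology AddCommGrpCat.{max u v}}
    (f : G ⟶ H) [Epi f] {c : A} (x : H.obj.obj (op c)) :
    ∃ (b : A) (j : b ⟶ c) (_ : E.AdmissibleEpi j) (y : G.obj.obj (op b)),
      f.hom.app (op b) y = H.obj.map j.op x := by
  have := (Sheaf.isLocallySurjective_iff_epi' (φ := f)).2 inferInstance
  obtain ⟨b, j, hj, y, hy⟩ := Presheaf.imageSieve_mem hE.topology f.hom x
  exact ⟨b, j, hj, y, hy⟩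

/-- A section of the quotient lifts to `G` along an admissible epimorphism `j`. Pulling `j` back
along both maps yields a cover on which their additivity is inherited from `G`, and restriction to a
cover is injective. -/
instance : hE.additiveSheaf.IsClosedUnderQuotients where
  prop_of_epi {G H} f hf h := by
    have : G.obj.Additive := h
    refine ⟨fun {c d p q} => ?_⟩
    ext x
    obtain ⟨b, j, hj, y, hy⟩ := hE.exists_admissibleEpi_of_epi (c := c.unop) f x
    obtain ⟨d₁, j₁, p', hp, hj₁⟩ := hE.pullback_epi j p.unop hj
    obtain ⟨d₂, j₂, q', hq, hj₂⟩ := hE.pullback_epi j (j₁ ≫ q.unop) hj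
    refine hE.injective_map_of_admissibleEpi H (hE.comp_epi _ _ hj₂ hj₁) ?_
    have key {r : d₂ ⟶ b} {s : d.unop ⟶ c.unop} (h : r ≫ j = (j₂ ≫ j₁) ≫ s) :
        H.obj.map (j₂ ≫ j₁).op (H.obj.map s.op x) = f.hom.app _ (G.obj.map r.op y) := by
      rw [NatTrans.naturality_apply, hy, ← ConcreteCategory.comp_apply, ← Functor.map_comp,
        ← op_comp, ← h, op_comp, Functor.map_comp, ConcreteCategory.comp_apply]
    have h₁ : (j₂ ≫ p') ≫ j = (j₂ ≫ j₁) ≫ p.unop := by simp [hp.w]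
    have h₂ : q' ≫ j = (j₂ ≫ j₁) ≫ q.unop := by simp [hq.w]
    have h₃ : (j₂ ≫ p' + q') ≫ j = (j₂ ≫ j₁) ≫ (p.unop + q.unop) := by
      rw [Preadditive.add_comp, h₁, h₂, Preadditive.comp_add]
    refine (key h₃).trans ?_
    rw [op_add, G.obj.map_add]
    change f.hom.app _ (G.obj.map (j₂ ≫ p').op y + G.obj.map q'.op y) =
      H.obj.map (j₂ ≫ j₁).op (H.obj.map p.unop.op x + H.obj.map q.unop.op x)
    rw [map_add, map_add, key h₁, key h₂]

instance : hE.additiveSheaf.IsClosedUnderFiniteProducts where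
  isClosedUnderLimitsOfShape J _ := by
    refine ⟨?_⟩
    rintro G ⟨p⟩
    have (j : Discrete J) : (p.diag.obj j).obj.Additive := p.prop_diag_obj j
    refine additive_of_jointly_mono (fun j => (p.π.app j).hom) fun {a T} x y hxy => ?_
    exact (isLimitOfPreserves (sheafToPresheaf _ _ ⋙ (evaluation _ _).obj a) p.isLimit).hom_ext hxy

instance : hE.additiveSheaf.ContainsZero where
  exists_zero := ⟨⊤_ _, (isZero_zero _).of_iso HasZeroObject.zeroIsoTerminal.symm,
    hE.additiveSheaf.prop_of_isLimit (limit.isLimit (Functor.empty.{0} _)) fun ⟨j⟩ => j.elim⟩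

/-- The objects of the abelian envelope are sheaves. -/
def IsExact.envelopeToSheaf : E.Envelope ⥤ Sheaf hE.topology AddCommGrpCat.{max u v} :=
  ObjectProperty.lift _ E.leftExact.ι fun G =>
    have : G.obj.Additive := G.property.1
    (hE.leftExact_iff_isSheaf G.obj).1 G.property

instance : hE.envelopeToSheaf.Full := by unfold IsExact.envelopeToSheaf; infer_instance
instance : hE.envelopeToSheaf.Faithful := by unfold IsExact.envelopeToSheaf; infer_instance

theorem IsExact.additiveSheaf_envelopeToSheaf (G : E.Envelope) :
    hE.additiveSheaf (hE.envelopeToSheaf.obj G) :=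
  G.property.1

/-- The abelian envelope is the category of additive sheaves. -/
def IsExact.envelopeToAdditiveSheaf : E.Envelope ⥤ hE.additiveSheaf.FullSubcategory :=
  hE.additiveSheaf.lift hE.envelopeToSheaf hE.additiveSheaf_envelopeToSheaf

instance : hE.envelopeToAdditiveSheaf.Full := by
  unfold IsExact.envelopeToAdditiveSheaf; infer_instance
instance : hE.envelopeToAdditiveSheaf.Faithful := by
  unfold IsExact.envelopeToAdditiveSheaf; infer_instance
instance : hE.envelopeToAdditiveSheaf.EssSurj where
  mem_essImage G :=
    have : G.obj.obj.Additive := G.property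
    ⟨⟨G.obj.obj, (hE.leftExact_iff_isSheaf G.obj.obj).2 G.obj.property⟩, ⟨Iso.refl _⟩⟩
instance : hE.envelopeToAdditiveSheaf.IsEquivalence where

/-- The abelian envelope of an exact category is abelian. -/
@[reducible]
noncomputable def IsExact.envelopeAbelian : Abelian E.Envelope :=
  have : HasFiniteProducts E.Envelope :=
    ⟨fun _ => Adjunction.hasLimitsOfShape_of_equivalence hE.envelopeToAdditiveSheaf⟩
  abelianOfEquivalence hE.envelopeToAdditiveSheaf

theorem IsExact.exists_of_epi_envelope (hE : E.IsExact) {G H : E.Envelope} (f : G ⟶ H) [Epi f] {c : A}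
    (x : H.obj.obj (op c)) :
    ∃ (b : A) (j : b ⟶ c) (_ : E.AdmissibleEpi j) (y : G.obj.obj (op b)),
      f.hom.app (op b) y = H.obj.map j.op x :=
  have := hE.additiveSheaf.preservesEpimorphisms_ι_of_isNormalMonoCategory
  hE.exists_admissibleEpi_of_epi ((hE.envelopeToAdditiveSheaf ⋙ hE.additiveSheaf.ι).map f) x

end SequenceClass

end IndPro

/-! ### An exact category is closed under extensions in its envelope. -/

namespace IndPro

namespace SequenceClass

variable {A : Type u} [Category.{v} A] [Preadditive A] {E : SequenceClass A}

/-- Existence in the additive Yoneda lemma; uniqueness is `yonedaUlift_hom_ext` and needs no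
additivity. -/
theorem exists_hom_of_section {G : Aᵒᵖ ⥤ AddCommGrpCat.{max u v}} [G.Additive] {c : A}
    (y : G.obj (op c)) : ∃ t : yonedaUlift.obj c ⟶ G,
      ∀ {d : A} (g : d ⟶ c), t.app (op d) (ULift.up g) = G.map g.op y := by
  refine ⟨{ app d := AddCommGrpCat.ofHom (AddMonoidHom.mk'
              (fun g : ULift.{u} (d.unop ⟶ c) => G.map g.down.op y) fun g g' => ?_)
            naturality d d' f := ?_ }, fun g => rfl⟩
  · change G.map (g.down.op + g'.down.op) y = _
    rw [G.map_add]
    rfl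
  · ext g
    exact ConcreteCategory.congr_hom (G.map_comp (show d.unop ⟶ c from g.down).op f) y

theorem section_eq_of_hom {G : Aᵒᵖ ⥤ AddCommGrpCat.{max u v}} {c d : A}
    (t : yonedaUlift.obj c ⟶ G) (g : d ⟶ c) :
    t.app (op d) (ULift.up g) = G.map g.op (t.app (op c) (ULift.up (𝟙 c))) := by
  refine Eq.trans ?_ (NatTrans.naturality_apply t g.op (ULift.up (𝟙 c)))
  exact congrArg (fun x => t.app (op d) (ULift.up x)) (Category.comp_id g).symm

theorem yonedaUlift_hom_ext {G : Aᵒᵖ ⥤ AddCommGrpCat.{max u v}} {c : A}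
    {t t' : yonedaUlift.obj c ⟶ G}
    (h : t.app (op c) (ULift.up (𝟙 c)) = t'.app (op c) (ULift.up (𝟙 c))) : t = t' := by
  ext d ⟨g⟩
  exact (section_eq_of_hom t g).trans ((congrArg _ h).trans (section_eq_of_hom t' g).symm)

instance : PreservesFiniteLimits (yonedaUlift (A := A)) where
  preservesFiniteLimits J _ _ := preservesLimitsOfShape_of_evaluation _ _ fun d =>
    preservesLimitsOfShape_of_natIso (F := preadditiveCoyoneda.obj d ⋙ AddCommGrpCat.uliftFunctor)
      (NatIso.ofComponents fun c => Iso.refl _)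

instance : PreservesFiniteLimits E.quillenEmbedding :=
  have : PreservesFiniteLimits (E.quillenEmbedding ⋙ E.leftExact.ι) :=
    inferInstanceAs (PreservesFiniteLimits yonedaUlift)
  preservesFiniteLimits_of_reflects_of_preserves _ E.leftExact.ι

theorem epi_quillenEmbedding_map {b c : A} {j : b ⟶ c} (hj : E.AdmissibleEpi j) :
    Epi (E.quillenEmbedding.map j) := by
  refine Preadditive.epi_of_cancel_zero _ fun {G} t ht => ?_
  obtain ⟨a, i, w, hm⟩ := hj
  apply ObjectProperty.hom_ext
  refine yonedaUlift_hom_ext ((G.property.2 _ hm).1 ?_)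
  have h₁ := congrArg (fun f : E.quillenEmbedding.obj b ⟶ G =>
    f.hom.app (op b) (ULift.up (𝟙 b))) ht
  have h₂ := section_eq_of_hom t.hom j
  refine (h₂.symm.trans (Eq.trans ?_ h₁)).trans ?_
  · exact congrArg (fun x => t.hom.app (op b) (ULift.up x)) (Category.id_comp j).symm
  · exact (map_zero (G.obj.map j.op).hom).symm

theorem shortExact_map_quillenEmbedding (hE : E.IsExact) {S : ShortComplex A} (hS : E.mem S) :
    letI := hE.envelopeAbelian
    (S.map E.quillenEmbedding).ShortExact := by
  let := hE.envelopeAbelian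
  obtain ⟨⟨hl⟩, -⟩ := E.isKernelCokernelPair hS
  have hl' := (KernelFork.isLimitMapConeEquiv _ E.quillenEmbedding)
    (isLimitOfPreserves E.quillenEmbedding hl)
  exact
  { exact := ShortComplex.exact_of_f_is_kernel _ hl'
    mono_f := mono_of_isLimit_fork hl'
    epi_g := epi_quillenEmbedding_map ⟨_, S.f, S.zero, hS⟩ }

/-- The pushout is an extension of `C` by `Y`, so the short five lemma applies. This identifies a
pushout in the envelope both with a given extension and with the image of a pushout in `A`. -/
theorem isIso_desc_of_shortExact {D : Type*} [Category* D] [Abelian D] {P X Y Z W C : D}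
    {f : Z ⟶ X} {g : Z ⟶ Y} {inl : X ⟶ P} {inr : Y ⟶ P} (h : IsPushout f g inl inr)
    {c : X ⟶ C} {w : f ≫ c = 0} (hc : (ShortComplex.mk f c w).ShortExact)
    {C' : D} {k : Y ⟶ W} {q : W ⟶ C'} {w' : k ≫ q = 0} (hW : (ShortComplex.mk k q w').ShortExact)
    (m : X ⟶ W) (hm : f ≫ m = g ≫ k) (α : C ⟶ C') [IsIso α] (hα : m ≫ q = c ≫ α) :
    IsIso (h.desc m k hm) := by
  have h₁ := shortExact_of_isPushout h hc
  let φ : ShortComplex.mk inr (h.desc c 0 (by simp [w])) (by simp) ⟶ ShortComplex.mk k q w' :=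
    { τ₁ := 𝟙 Y
      τ₂ := h.desc m k hm
      τ₃ := α
      comm₁₂ := by simp
      comm₂₃ := by
        dsimp
        apply h.hom_ext
        · simp [hα]
        · simp [w'] }
  have : IsIso φ.τ₁ := inferInstanceAs (IsIso (𝟙 Y))
  have : IsIso φ.τ₃ := ‹_›
  exact ShortComplex.isIso₂_of_shortExact_of_isIso₁₃ φ h₁ hW

/-- An exact category is closed under extensions in its abelian envelope. -/
theorem IsExact.isClosedUnderExtensions_quillenEmbedding (hE : E.IsExact) :
    E.quillenEmbedding.essImage.IsClosedUnderExtensions := by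
  let := hE.envelopeAbelian
  refine ⟨fun {S} hS h₁ h₃ => ?_⟩
  obtain ⟨a, ⟨e₁⟩⟩ := h₁
  obtain ⟨c, ⟨e₃⟩⟩ := h₃
  let h := E.quillenEmbedding
  have hz : (e₁.hom ≫ S.f) ≫ S.g ≫ e₃.inv = 0 := by simp
  have hS' : (ShortComplex.mk (e₁.hom ≫ S.f) (S.g ≫ e₃.inv) hz).ShortExact :=
    ShortComplex.shortExact_of_iso (ShortComplex.isoMk e₁.symm (Iso.refl _) e₃.symm
      (by simp) (by simp)) hS
  generalize hk : e₁.hom ≫ S.f = k at hz hS'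
  generalize hq : S.g ≫ e₃.inv = q at hz hS'
  have : Epi q := hS'.epi_g
  -- The section to lift is the identity of `c`; its lift `y` over `c'` is a map `m : h c' → X₂`
  -- over `h j`.
  obtain ⟨c', j, hj, y, hy⟩ := hE.exists_of_epi_envelope q (c := c) (ULift.up (𝟙 c))
  have : S.X₂.obj.Additive := S.X₂.property.1
  obtain ⟨t, ht⟩ := exists_hom_of_section y
  let m : h.obj c' ⟶ S.X₂ := ObjectProperty.homMk t
  have hm : m ≫ q = h.map j := by
    apply ObjectProperty.hom_ext
    apply yonedaUlift_hom_ext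
    refine ((congrArg _ ((ht (𝟙 c')).trans (by simp))).trans hy).trans ?_
    exact congrArg ULift.up ((Category.comp_id j).trans (Category.id_comp j).symm)
  obtain ⟨a', i, w, hij⟩ := hj
  obtain ⟨⟨-⟩, ⟨hjc⟩⟩ := E.isKernelCokernelPair hij
  obtain ⟨φ', hφ'⟩ := exists_lift_of_shortExact hS' (h.map i ≫ m) (by
    rw [Category.assoc, hm, ← h.map_comp, w, h.map_zero])
  obtain ⟨φ, rfl⟩ := h.map_surjective φ'
  obtain ⟨d, i', f', hP, ⟨e, l, w', hd⟩⟩ := hE.pushout_mono i φ ⟨_, j, w, hij⟩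
  obtain ⟨⟨-⟩, ⟨hlc⟩⟩ := E.isKernelCokernelPair hd
  -- The cokernel of `i'` is again `c`: `α` and `β` are the mutually inverse comparisons.
  obtain ⟨α, hα⟩ := CokernelCofork.IsColimit.desc' hjc (f' ≫ l) (by
    dsimp
    rw [hP.w_assoc, w', comp_zero])
  obtain ⟨β, hβ⟩ := CokernelCofork.IsColimit.desc' hlc (hP.desc j 0 (by simp [w])) (by simp)
  dsimp at hα hβ
  have hαβ : α ≫ β = 𝟙 _ := Cofork.IsColimit.hom_ext hjc (by
    dsimp
    rw [reassoc_of% hα, hβ, hP.inl_desc, Category.comp_id])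
  have hβα : β ≫ α = 𝟙 _ := Cofork.IsColimit.hom_ext hlc (by
    dsimp
    rw [reassoc_of% hβ, Category.comp_id]
    apply hP.hom_ext <;> simp [hα, w'])
  have : IsIso α := ⟨β, hαβ, hβα⟩
  have hD := IsPushout.of_hasPushout (h.map i) (h.map φ)
  have hij' := shortExact_map_quillenEmbedding hE hij
  have := isIso_desc_of_shortExact hD hij' hS' m hφ'.symm (𝟙 _)
    (hm.trans (Category.comp_id _).symm)
  have := isIso_desc_of_shortExact hD hij' (shortExact_map_quillenEmbedding hE hd) (h.map f')
    (by rw [← h.map_comp, ← h.map_comp, hP.w]) (h.map α) (by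
      dsimp
      rw [← h.map_comp, ← h.map_comp, hα])
  exact ⟨d, ⟨(asIso (hD.desc (h.map f') (h.map i') _)).symm ≪≫ asIso (hD.desc m k hφ'.symm)⟩⟩

end SequenceClass

end IndPro

/-! ### Exactness of `Ind(A)`, `Pro(A)` and their iterates. -/

namespace IndPro

namespace SequenceClass

variable {A : Type u} [Category.{v} A] [Preadditive A] {E : SequenceClass A}

theorem IsExact.isClosedUnderExtensions_indMap (hE : E.IsExact) :
    (indMap E.quillenEmbedding).essImage.IsClosedUnderExtensions :=
  let := hE.envelopeAbelian
  have := hE.isClosedUnderExtensions_quillenEmbedding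
  IndPro.isClosedUnderExtensions_indMap E.quillenEmbedding

theorem IsExact.isClosedUnderExtensions_indMap_op (hE : E.IsExact) :
    (indMap E.quillenEmbedding.op).essImage.IsClosedUnderExtensions :=
  let := hE.envelopeAbelian
  have := hE.isClosedUnderExtensions_quillenEmbedding
  have := isClosedUnderExtensions_op_essImage E.quillenEmbedding
  IndPro.isClosedUnderExtensions_indMap E.quillenEmbedding.op

theorem IsExact.isClosedUnderExtensions_proMap (hE : E.IsExact) :
    (proMap E.quillenEmbedding).essImage.IsClosedUnderExtensions :=
  let := hE.envelopeAbelian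
  have := hE.isClosedUnderExtensions_indMap_op
  isClosedUnderExtensions_op_essImage (indMap E.quillenEmbedding.op)

theorem IsExact.ind (hE : E.IsExact) : E.ind.IsExact := by
  let := hE.envelopeAbelian
  have := hE.hasFiniteBiproducts
  have : HasBinaryBiproducts (Ind A) := HasBinaryBiproducts.of_hasBinaryProducts
  have := hE.isClosedUnderExtensions_indMap
  have := additive_of_fullyFaithful (indMap E.quillenEmbedding)
  exact isExact_of_isClosedUnderExtensions (F := indMap E.quillenEmbedding) fun _ => Iff.rfl

theorem IsExact.pro (hE : E.IsExact) : E.pro.IsExact := by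
  let := hE.envelopeAbelian
  have := hE.hasFiniteBiproducts
  have : HasFiniteBiproducts Aᵒᵖ := HasFiniteBiproducts.of_hasFiniteProducts
  have : HasFiniteBiproducts (Pro A) := HasFiniteBiproducts.of_hasFiniteProducts
  have : HasBinaryBiproducts (Pro A) := HasBinaryBiproducts.of_hasBinaryProducts
  have := hE.isClosedUnderExtensions_proMap
  have := additive_of_fullyFaithful (proMap E.quillenEmbedding)
  exact isExact_of_isClosedUnderExtensions (F := proMap E.quillenEmbedding) fun _ => Iff.rfl

end SequenceClass

theorem CatWithSequences.isExact_apply (C : CatWithSequences.{v, u}) (hC : C.seq.IsExact) :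
    ∀ s : Step, (C.apply s).seq.IsExact
  | .ind => hC.ind
  | .pro => hC.pro

theorem CatWithSequences.isExact_iterated (C : CatWithSequences.{v, u}) (hC : C.seq.IsExact)
    (s : Step) : ∀ l : List Step, (C.iterated s l).seq.IsExact
  | [] => C.isExact_apply hC s
  | t :: l => (C.iterated s l).isExact_apply (C.isExact_iterated hC s l) t

end IndPro

open IndPro
theorem mainTheorem5 {A : Type u} [Category.{v} A] [Preadditive A] (E : SequenceClass A)
    (hE : E.IsExact) :
    -- `Ind(F)` and `Pro(F)` are abelian
    (∃ ab : Abelian (Ind E.Envelope), ab.toPreadditive = indPreadditive) ∧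
    (∃ ab : Abelian (Pro E.Envelope),
      ab.toPreadditive = (inferInstance : Preadditive (Pro E.Envelope))) ∧
    -- `Ind(A)` and `Pro(A)` are full subcategories of them, closed under extensions
    ((indMap E.quillenEmbedding).Full ∧ (indMap E.quillenEmbedding).Faithful ∧
      (indMap E.quillenEmbedding).essImage.IsClosedUnderExtensions) ∧
    ((proMap E.quillenEmbedding).Full ∧ (proMap E.quillenEmbedding).Faithful ∧
      (proMap E.quillenEmbedding).essImage.IsClosedUnderExtensions) ∧
    -- the induced classes of short exact sequences are exact structures
    E.ind.IsExact ∧ E.pro.IsExact ∧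
    -- so are the classes obtained by iterating
    ∀ (s : Step) (l : List Step),
      (CatWithSequences.iterated { carrier := A, seq := E } s l).seq.IsExact := by
  let := hE.envelopeAbelian
  exact ⟨⟨indAbelian, rfl⟩, ⟨inferInstanceAs (Abelian (Ind E.Envelopeᵒᵖ)ᵒᵖ), rfl⟩,
    ⟨inferInstance, inferInstance, hE.isClosedUnderExtensions_indMap⟩,
    ⟨inferInstance, inferInstance, hE.isClosedUnderExtensions_proMap⟩, hE.ind, hE.pro,
    CatWithSequences.isExact_iterated { carrier := A, seq := E } hE⟩
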